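/- Let $\mu$ be an $N\times N$ matrix measure, i.e. a $\sigma$-additive map from the Borel sets of $\mathbb{R}$ to the positive semi-definite matrices in $M_N(\mathbb{C})$. Let $\tau_\mu=\mathrm{Tr}\,\mu$ and let $W=d\mu/d\tau_\mu$ be its density. Assume that $\tau_\mu$ has infinite support, that $x\mapsto x^kW_{i,j}(x)$ is in $L^1(\tau_\mu)$ for all $i,j$ and all $k\in\mathbb{N}$, and that $W(x)$ is positive definite for $\tau_\mu$-almost every $x$. Let $(P_n)_{n\ge 0}$ be matrix-valued orthonormal polynomials for $\mu$: $P_n$ has coefficients in $M_N(\mathbb{C})$, degree $n$ and invertible leading coefficient, and $$\int_{\mathbb{R}} P_n(x)\,W(x)\,P_m^*(x)\,d\tau_\mu(x)=\delta_{n,m}I,\qquad P_m^*(x)=P_m(x)^*\quad (x\in\mathbb{R}).$$ Put $A_n=\int x P_n W P_{n+1}^*\,d\tau_\mu$ and $B_n=\int xP_nWP_n^*\,d\tau_\mu$. Let $\ell^2(\mathbb{C}^N)$ be the Hilbert space of square-summable sequences $V=\sum_{n\ge0}e_n\otimes v_n$ with $v_n\in\mathbb{C}^N$, let $\mathcal{D}$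 be its subspace of finitely supported sequences, and let $J:\mathcal{D}\to\ell^2(\mathbb{C}^N)$ be the block Jacobi operator $$JV=e_0\otimes(A_0v_1+B_0v_0)+\sum_{n\ge1}e_n\otimes(A_nv_{n+1}+B_nv_n+A_{n-1}^*v_{n-1}),$$ with adjoint $(J^*,\mathcal{D}^*)$. Let $L^2_v(\mu)$ be the space of Borel measurable $f:\mathbb{R}\to\mathbb{C}^N$ with $\int f^*Wf\,d\tau_\mu<\infty$, modulo those for which this integral is $0$, with inner product $\langle f,g\rangle=\int g^*Wf\,d\tau_\mu$, and let $M_z$ be multiplication by the variable, $(M_zf)(x)=xf(x)$, on $L^2_v(\mu)$ with its maximal domain $\mathcal{D}(M_z)$. Suppose that $(J,\mathcal{D})$ is essentially self-adjoint, i.e. that its closure is self-adjoint. Then every $A_n$ is invertible, every $B_n$ is self-adjoint, and these are the coefficients of the three-term recurrence $zP_n=A_nP_{n+1}+B_nP_n+A_{n-1}^*P_{n-1}$ for $n\ge1$, $zP_0=A_0P_1+B_0P_0$. Moreover: 1. The closure of $(J,\mathcal{D})$ is $(J^*,\mathcal{D}^*)$. 2. For all $n$ and all $v\in\mathbb{C}^N$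 the function $P_n^*(\cdot)v$ is in $L^2_v(\mu)$, and there is a unitary map from $\ell^2(\mathbb{C}^N)$ onto $L^2_v(\mu)$, $$\mathcal{U}:\ \sum_{n\ge0}e_n\otimes v_n\ \longmapsto\ \sum_{n\ge0}P_n^*(\cdot)v_n,$$ where the series converges (unconditionally) in $L^2_v(\mu)$. 3. $\mathcal{U}J^*=M_z\,\mathcal{U}$: one has $V\in\mathcal{D}^*$ if and only if $\mathcal{U}V\in\mathcal{D}(M_z)$, and then $\mathcal{U}J^*V=M_z\,\mathcal{U}V$. 4. There is a resolution of the identity $E$ of $\ell^2(\mathbb{C}^N)$ on the Borel sets of $\mathbb{R}$ with $J^*=\int_{\mathbb{R}}t\,dE(t)$ (that is, $V\in\mathcal{D}^*$ if and only if $\int t^2\,dE_{V,V}(t)<\infty$, and $\langle J^*V,V'\rangle=\int t\,dE_{V,V'}(t)$ for all $V\in\mathcal{D}^*$ and all $V'$, where $E_{V,V'}(B)=\langle E(B)V,V'\rangle$), and $$\langle E(B)(e_k\otimes v),\,e_n\otimes w\rangle=w^*\Bigl(\int_B P_n(x)\,W(x)\,P_k^*(x)\,d\tau_\mu(x)\Bigr)v$$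 for all Borel sets $B$, all $k,n\ge0$ and all $v,w\in\mathbb{C}^N$. (For $B=\mathbb{R}$ this is the matrix orthogonality of the $P_n$.) -/

import Mathlib

open MeasureTheory Matrix
open scoped ENNReal LinearPMap ComplexOrder

noncomputable section

/-! ### Matrix measures -/

/-- A matrix-valued measure: a `σ`-additive map from the Borel sets of `ℝ` to the positive
semi-definite complex `N × N` matrices.  (By Mathlib's convention a vector measure is `0` on
non-measurable sets.) -/
structure MatrixMeasure (N : ℕ) where
  /-- the underlying `σ`-additive set function -/
  toVectorMeasure : VectorMeasure ℝ (Matrix (Fin N) (Fin N) ℂ)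
  /-- all values are positive semi-definite -/
  posSemidef' : ∀ B : Set ℝ, MeasurableSet B → (toVectorMeasure B).PosSemidef

namespace MatrixMeasure

variable {N : ℕ} (μ : MatrixMeasure N)

theorem posSemidef (B : Set ℝ) : (μ.toVectorMeasure B).PosSemidef := by
  by_cases hB : MeasurableSet B
  · exact μ.posSemidef' B hB
  · rw [VectorMeasure.not_measurable _ hB]
    exact PosSemidef.zero

/-- The `(i, j)` entry `μ_{i,j}(B) = ⟨μ(B) e_j, e_i⟩`, a complex Borel measure. -/
def entry (i j : Fin N) : ComplexMeasure ℝ :=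
  μ.toVectorMeasure.mapRange (entryAddMonoidHom ℂ i j)
    (continuous_id.matrix_elem i j)

theorem entry_apply (i j : Fin N) (B : Set ℝ) : μ.entry i j B = μ.toVectorMeasure B i j := rfl

/-- The trace of `μ`, as a signed measure. -/
def signedTrace : SignedMeasure ℝ :=
  μ.toVectorMeasure.mapRange (Complex.reAddGroupHom.comp (traceAddMonoidHom (Fin N) ℂ))
    (Complex.continuous_re.comp continuous_id.matrix_trace)

theorem signedTrace_apply (B : Set ℝ) : μ.signedTrace B = (μ.toVectorMeasure B).trace.re := rfl

theorem signedTrace_nonneg : 0 ≤[Set.univ] μ.signedTrace := by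
  rw [VectorMeasure.le_restrict_univ_iff_le]
  intro B _
  rw [signedTrace_apply]
  exact (Complex.nonneg_iff.1 (μ.posSemidef B).trace_nonneg).1

/-- The trace measure `τ_μ(B) = Tr μ(B)`, a finite positive Borel measure. -/
def traceMeasure : Measure ℝ :=
  μ.signedTrace.toMeasureOfZeroLE Set.univ MeasurableSet.univ μ.signedTrace_nonneg

instance : IsFiniteMeasure μ.traceMeasure := by
  unfold traceMeasure; infer_instance

theorem traceMeasure_real {B : Set ℝ} (hB : MeasurableSet B) :
    μ.traceMeasure.real B = (μ.toVectorMeasure B).trace.re := by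
  rw [traceMeasure, SignedMeasure.toMeasureOfZeroLE_real_apply _ _ _ hB, Set.univ_inter,
    signedTrace_apply]

/-- The density `W = dμ/dτ_μ`, with entries the Radon–Nikodym derivatives of `μ_{i,j}`. -/
def weight (x : ℝ) : Matrix (Fin N) (Fin N) ℂ :=
  Matrix.of fun i j => (μ.entry i j).rnDeriv μ.traceMeasure x

theorem measurable_weight (i j : Fin N) : Measurable fun x => μ.weight x i j := by
  have h : (fun x => μ.weight x i j) = fun x =>
      (((μ.entry i j).re.rnDeriv μ.traceMeasure x : ℝ) : ℂ) +
        (((μ.entry i j).im.rnDeriv μ.traceMeasure x : ℝ) : ℂ) * Complex.I := by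
    funext x
    exact (Complex.re_add_im _).symm
  rw [h]
  exact (Complex.measurable_ofReal.comp (SignedMeasure.measurable_rnDeriv _ _)).add
    ((Complex.measurable_ofReal.comp (SignedMeasure.measurable_rnDeriv _ _)).mul_const _)

theorem integrable_weight (i j : Fin N) :
    Integrable (fun x => μ.weight x i j) μ.traceMeasure :=
  ComplexMeasure.integrable_rnDeriv _ _

theorem toVectorMeasure_eq_zero {B : Set ℝ} (hB : MeasurableSet B)
    (h : μ.traceMeasure B = 0) : μ.toVectorMeasure B = 0 := by
  rw [← (μ.posSemidef B).trace_eq_zero_iff]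
  have h0 : (μ.toVectorMeasure B).trace.re = 0 := by
    rw [← μ.traceMeasure_real hB, measureReal_def, h, ENNReal.toReal_zero]
  have h1 := (Complex.nonneg_iff.1 (μ.posSemidef B).trace_nonneg).2
  exact Complex.ext h0 h1.symm

/-- `W` is the density of `μ` with respect to its trace measure. -/
theorem setIntegral_weight (i j : Fin N) {B : Set ℝ} (hB : MeasurableSet B) :
    ∫ x in B, μ.weight x i j ∂μ.traceMeasure = μ.toVectorMeasure B i j := by
  have hz : ∀ C : Set ℝ, MeasurableSet C → μ.traceMeasure C = 0 → μ.entry i j C = 0 := by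
    intro C hC h
    rw [entry_apply, μ.toVectorMeasure_eq_zero hC h]
    rfl
  have hre : μ.traceMeasure.withDensityᵥ ((μ.entry i j).re.rnDeriv μ.traceMeasure)
      = (μ.entry i j).re := by
    rw [← SignedMeasure.absolutelyContinuous_iff_withDensityᵥ_rnDeriv_eq]
    refine VectorMeasure.AbsolutelyContinuous.mk fun C hC h => ?_
    rw [Measure.toENNRealVectorMeasure_apply_measurable hC] at h
    exact congrArg Complex.re (hz C hC h)
  have him : μ.traceMeasure.withDensityᵥ ((μ.entry i j).im.rnDeriv μ.traceMeasure)
      = (μ.entry i j).im := by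
    rw [← SignedMeasure.absolutelyContinuous_iff_withDensityᵥ_rnDeriv_eq]
    refine VectorMeasure.AbsolutelyContinuous.mk fun C hC h => ?_
    rw [Measure.toENNRealVectorMeasure_apply_measurable hC] at h
    exact congrArg Complex.im (hz C hC h)
  have hint := (μ.integrable_weight i j).integrableOn (s := B)
  apply Complex.ext
  · have h1 := congrArg (fun s => s B) hre
    rw [withDensityᵥ_apply (SignedMeasure.integrable_rnDeriv _ _) hB] at h1
    have h2 := integral_re hint
    exact (h2.symm.trans h1)
  · have h1 := congrArg (fun s => s B) him
    rw [withDensityᵥ_apply (SignedMeasure.integrable_rnDeriv _ _) hB] at h1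
    have h2 := integral_im hint
    exact (h2.symm.trans h1)

theorem quad_eq_sum (A : Matrix (Fin N) (Fin N) ℂ) (u v : Fin N → ℂ) :
    star u ⬝ᵥ (A *ᵥ v) = ∑ i, ∑ j, star (u i) * A i j * v j := by
  simp only [dotProduct, mulVec, Finset.mul_sum, Pi.star_apply, mul_assoc]

/-- The density is positive semi-definite almost everywhere. -/
theorem weight_posSemidef : ∀ᵐ x ∂μ.traceMeasure, (μ.weight x).PosSemidef := by
  have hherm : ∀ᵐ x ∂μ.traceMeasure, ∀ i j, star (μ.weight x j i) = μ.weight x i j := by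
    rw [ae_all_iff]; intro i
    rw [ae_all_iff]; intro j
    have hi : Integrable (fun x => star (μ.weight x j i)) μ.traceMeasure :=
      Complex.conjCLE.toContinuousLinearMap.integrable_comp (μ.integrable_weight j i)
    refine Integrable.ae_eq_of_forall_setIntegral_eq _ _ hi (μ.integrable_weight i j) ?_
    intro B hB _
    have h := integral_conj (μ := μ.traceMeasure.restrict B) (f := fun x => μ.weight x j i)
    rw [μ.setIntegral_weight j i hB] at h
    rw [μ.setIntegral_weight i j hB]
    refine h.trans ?_
    exact (μ.posSemidef B).isHermitian.apply i j
  have hint : ∀ v : Fin N → ℂ,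
      Integrable (fun x => star v ⬝ᵥ (μ.weight x *ᵥ v)) μ.traceMeasure := by
    intro v
    simp only [quad_eq_sum]
    exact integrable_finsetSum _ fun i _ => integrable_finsetSum _ fun j _ =>
      ((μ.integrable_weight i j).const_mul _).mul_const _
  have hv : ∀ v : Fin N → ℂ, ∀ᵐ x ∂μ.traceMeasure, 0 ≤ (star v ⬝ᵥ (μ.weight x *ᵥ v)).re := by
    intro v
    refine ae_nonneg_of_forall_setIntegral_nonneg (hint v).re ?_
    intro B hB _
    have h1 : ∫ x in B, star v ⬝ᵥ (μ.weight x *ᵥ v) ∂μ.traceMeasure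
        = star v ⬝ᵥ (μ.toVectorMeasure B *ᵥ v) := by
      simp only [quad_eq_sum]
      rw [integral_finsetSum _ fun i _ => integrable_finsetSum _ fun j _ =>
        (((μ.integrable_weight i j).const_mul _).mul_const _).integrableOn]
      refine Finset.sum_congr rfl fun i _ => ?_
      rw [integral_finsetSum _ fun j _ =>
        (((μ.integrable_weight i j).const_mul _).mul_const _).integrableOn]
      refine Finset.sum_congr rfl fun j _ => ?_
      rw [integral_mul_const, integral_const_mul, μ.setIntegral_weight i j hB]
    have h2 := integral_re ((hint v).integrableOn (s := B))
    have h3 := (μ.posSemidef B).dotProduct_mulVec_nonneg v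
    rw [← h1] at h3
    exact (Complex.nonneg_iff.1 h3).1.trans_eq h2.symm
  have hd := ae_all_iff.2 fun n => hv (TopologicalSpace.denseSeq (Fin N → ℂ) n)
  filter_upwards [hherm, hd] with x hx hdx
  have hH : (μ.weight x).IsHermitian := by
    ext i j
    exact hx i j
  refine PosSemidef.of_dotProduct_mulVec_nonneg hH fun v => ?_
  have hre : 0 ≤ (star v ⬝ᵥ (μ.weight x *ᵥ v)).re := by
    have hc : Continuous fun v : Fin N → ℂ => (star v ⬝ᵥ (μ.weight x *ᵥ v)).re := by
      simp only [quad_eq_sum]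
      fun_prop
    have hcl : IsClosed {v : Fin N → ℂ | 0 ≤ (star v ⬝ᵥ (μ.weight x *ᵥ v)).re} :=
      isClosed_le continuous_const hc
    have hs : Set.range (TopologicalSpace.denseSeq (Fin N → ℂ)) ⊆
        {v : Fin N → ℂ | 0 ≤ (star v ⬝ᵥ (μ.weight x *ᵥ v)).re} := by
      rintro _ ⟨n, rfl⟩
      exact hdx n
    have := hcl.closure_subset_iff.2 hs
    rw [(TopologicalSpace.denseRange_denseSeq (Fin N → ℂ)).closure_range] at this
    exact this (Set.mem_univ v)
  have him : (star v ⬝ᵥ (μ.weight x *ᵥ v)).im = 0 := hH.im_star_dotProduct_mulVec_self v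
  exact Complex.nonneg_iff.2 ⟨hre, him.symm⟩

/-- The standing assumption: the trace measure has infinite support, all moments exist, and the
density is positive definite almost everywhere. -/
structure IsAdmissible : Prop where
  infinite_support : μ.traceMeasure.support.Infinite
  integrable_moment : ∀ (i j : Fin N) (k : ℕ),
    Integrable (fun x : ℝ => (x : ℂ) ^ k * μ.weight x i j) μ.traceMeasure
  posDef_weight : ∀ᵐ x ∂μ.traceMeasure, (μ.weight x).PosDef


/-! ### The Hilbert space `L²_v(μ)` -/

/-- The integrand `f(x)^* W(x) g(x)`. -/
def form (f g : ℝ → Fin N → ℂ) (x : ℝ) : ℂ :=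
  star (f x) ⬝ᵥ (μ.weight x *ᵥ g x)

theorem form_add_left (f g h : ℝ → Fin N → ℂ) (x : ℝ) :
    μ.form (f + g) h x = μ.form f h x + μ.form g h x := by
  simp [form, add_dotProduct]

theorem form_add_right (f g h : ℝ → Fin N → ℂ) (x : ℝ) :
    μ.form f (g + h) x = μ.form f g x + μ.form f h x := by
  simp [form, mulVec_add, dotProduct_add]

theorem form_smul_left (c : ℂ) (f g : ℝ → Fin N → ℂ) (x : ℝ) :
    μ.form (c • f) g x = star c * μ.form f g x := by
  simp [form, star_smul, smul_dotProduct]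

theorem form_smul_right (c : ℂ) (f g : ℝ → Fin N → ℂ) (x : ℝ) :
    μ.form f (c • g) x = c * μ.form f g x := by
  simp [form, mulVec_smul, dotProduct_smul]

theorem measurable_form {f g : ℝ → Fin N → ℂ} (hf : Measurable f) (hg : Measurable g) :
    Measurable (μ.form f g) := by
  have h : μ.form f g = fun x => ∑ i, ∑ j, star (f x i) * μ.weight x i j * g x j := by
    funext x
    exact quad_eq_sum _ _ _
  rw [h]
  refine Finset.measurable_fun_sum _ fun i _ => Finset.measurable_fun_sum _ fun j _ => ?_
  have h1 : Measurable fun x => star (f x i) :=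
    Complex.continuous_conj.measurable.comp ((measurable_pi_apply i).comp hf)
  exact (h1.mul (μ.measurable_weight i j)).mul ((measurable_pi_apply j).comp hg)

theorem form_self_nonneg (f : ℝ → Fin N → ℂ) : ∀ᵐ x ∂μ.traceMeasure, 0 ≤ μ.form f f x := by
  filter_upwards [μ.weight_posSemidef] with x hx
  exact hx.dotProduct_mulVec_nonneg _

theorem form_conj_symm (f g : ℝ → Fin N → ℂ) :
    ∀ᵐ x ∂μ.traceMeasure, star (μ.form g f x) = μ.form f g x := by
  filter_upwards [μ.weight_posSemidef] with x hx
  rw [form, form, star_dotProduct, star_mulVec, hx.isHermitian.eq, dotProduct_mulVec,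
    star_star, dotProduct_comm]

/-- The space `𝓛²_v(μ)` of Borel measurable `f : ℝ → ℂ^N` with `∫ f^* W f dτ_μ < ∞`. -/
def preL2 : Submodule ℂ (ℝ → Fin N → ℂ) where
  carrier := {f | Measurable f ∧ Integrable (μ.form f f) μ.traceMeasure}
  zero_mem' := by
    refine ⟨measurable_zero, ?_⟩
    have : μ.form 0 0 = 0 := by
      funext x
      simp [form]
    rw [this]
    exact integrable_zero _ _ _
  add_mem' := by
    rintro f g ⟨hf, hfi⟩ ⟨hg, hgi⟩
    refine ⟨hf.add hg, ?_⟩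
    refine Integrable.mono' ((hfi.norm.add hgi.norm).const_mul 2)
      (μ.measurable_form (hf.add hg) (hf.add hg)).aestronglyMeasurable ?_
    filter_upwards [μ.form_self_nonneg f, μ.form_self_nonneg g, μ.form_self_nonneg (f + g),
      μ.form_self_nonneg (f + (-1 : ℂ) • g)] with x h1 h2 h3 h4
    have key : μ.form (f + g) (f + g) x + μ.form (f + (-1 : ℂ) • g) (f + (-1 : ℂ) • g) x
        = 2 * (μ.form f f x + μ.form g g x) := by
      simp only [form_add_left, form_add_right, form_smul_left, form_smul_right]
      simp
      ring
    have e : ∀ z : ℂ, 0 ≤ z → ‖z‖ = z.re := fun z hz => by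
      have h0 := Complex.nonneg_iff.1 hz
      have : z = (z.re : ℂ) := Complex.ext rfl h0.2.symm
      rw [this, Complex.norm_real, Complex.ofReal_re, Real.norm_of_nonneg h0.1]
    simp only [Pi.add_apply]
    rw [e _ h1, e _ h2, e _ h3]
    have := congrArg Complex.re key
    have h5 := (Complex.nonneg_iff.1 h4).1
    simp only [Complex.add_re, Complex.mul_re, Complex.re_ofNat, Complex.im_ofNat, zero_mul,
      sub_zero] at this
    linarith
  smul_mem' := by
    rintro c f ⟨hf, hfi⟩
    refine ⟨hf.const_smul c, ?_⟩
    have : μ.form (c • f) (c • f) = fun x => star c * (c * μ.form f f x) := by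
      funext x
      rw [form_smul_left, form_smul_right]
    rw [this]
    exact (hfi.const_mul _).const_mul _

/-- The integrand of the inner product of two elements of `𝓛²_v(μ)` is integrable. -/
theorem integrable_form (f g : μ.preL2) :
    Integrable (μ.form (f : ℝ → Fin N → ℂ) g) μ.traceMeasure := by
  have hq : ∀ h : μ.preL2, Integrable (μ.form (h : ℝ → Fin N → ℂ) h) μ.traceMeasure :=
    fun h => h.2.2
  have key : μ.form (f : ℝ → Fin N → ℂ) g = fun x =>
      (1 / 4 : ℂ) * (μ.form ((f + g : μ.preL2) : ℝ → Fin N → ℂ) (f + g : μ.preL2) x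
        - μ.form ((f + (-1 : ℂ) • g : μ.preL2) : ℝ → Fin N → ℂ) (f + (-1 : ℂ) • g : μ.preL2) x
        - Complex.I * μ.form ((f + Complex.I • g : μ.preL2) : ℝ → Fin N → ℂ)
            (f + Complex.I • g : μ.preL2) x
        + Complex.I * μ.form ((f + (-Complex.I) • g : μ.preL2) : ℝ → Fin N → ℂ)
            (f + (-Complex.I) • g : μ.preL2) x) := by
    funext x
    simp only [Submodule.coe_add, Submodule.coe_smul, form_add_left, form_add_right,
      form_smul_left, form_smul_right]
    simp
    ring_nf
    simp [Complex.I_sq]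
    ring
  rw [key]
  exact ((((hq _).sub (hq _)).sub ((hq _).const_mul _)).add ((hq _).const_mul _)).const_mul _

/-- `𝓛²_v(μ)` as a type of its own, so that it carries only the topology of its seminorm. -/
def PreL2v : Type := μ.preL2

instance : AddCommGroup μ.PreL2v := inferInstanceAs (AddCommGroup μ.preL2)

instance : Module ℂ μ.PreL2v := inferInstanceAs (Module ℂ μ.preL2)

/-- The function underlying an element of `𝓛²_v(μ)`. -/
def PreL2v.fn {μ : MatrixMeasure N} (f : μ.PreL2v) : ℝ → Fin N → ℂ := f.1

/-- The semi-inner product `⟪f, g⟫ = ∫ f^* W g dτ_μ` on `𝓛²_v(μ)`, conjugate linear in the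
first argument as everywhere in Mathlib. -/
@[reducible] def preL2Core : PreInnerProductSpace.Core ℂ μ.PreL2v where
  inner f g := ∫ x, μ.form f.fn g.fn x ∂μ.traceMeasure
  conj_inner_symm f g := by
    rw [← integral_conj]
    exact integral_congr_ae (μ.form_conj_symm _ _)
  re_inner_nonneg f := by
    have h : 0 ≤ ∫ x, (μ.form f.fn f.fn x).re ∂μ.traceMeasure :=
      integral_nonneg_of_ae <| by
        filter_upwards [μ.form_self_nonneg f.fn] with x hx
        exact (Complex.nonneg_iff.1 hx).1
    exact h.trans_eq (integral_re (μ.integrable_form f f))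
  add_left f g h := by
    refine Eq.trans ?_ (integral_add (μ.integrable_form f h) (μ.integrable_form g h))
    refine integral_congr_ae (Filter.Eventually.of_forall fun x => ?_)
    exact μ.form_add_left _ _ _ x
  smul_left f g c := by
    rw [← integral_const_mul]
    refine integral_congr_ae (Filter.Eventually.of_forall fun x => ?_)
    exact μ.form_smul_left _ _ _ x

instance : SeminormedAddCommGroup μ.PreL2v :=
  @InnerProductSpace.Core.toSeminormedAddCommGroup ℂ μ.PreL2v _ _ _ μ.preL2Core

instance : InnerProductSpace ℂ μ.PreL2v :=
  InnerProductSpace.ofCore μ.preL2Core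

/-- `L²_v(μ)`: the quotient of `𝓛²_v(μ)` by the functions `f` with `⟪f, f⟫ = 0`. -/
abbrev L2v : Type := SeparationQuotient μ.PreL2v

/-- The class in `L²_v(μ)` of a function in `𝓛²_v(μ)`. -/
def toL2v (f : ℝ → Fin N → ℂ) (hf : f ∈ μ.preL2) : μ.L2v :=
  SeparationQuotient.mk (X := μ.PreL2v) ⟨f, hf⟩

theorem inner_toL2v {f g : ℝ → Fin N → ℂ} (hf : f ∈ μ.preL2) (hg : g ∈ μ.preL2) :
    inner ℂ (μ.toL2v f hf) (μ.toL2v g hg) = ∫ x, μ.form f g x ∂μ.traceMeasure := rfl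

/-- The graph of multiplication by the variable: all pairs `([f], [x ↦ x f(x)])` such that both
`f` and `x ↦ x f(x)` are in `𝓛²_v(μ)`. -/
def mulVarGraph : Submodule ℂ (μ.L2v × μ.L2v) where
  carrier := {p | ∃ (f : ℝ → Fin N → ℂ) (hf : f ∈ μ.preL2)
    (hg : (fun x : ℝ => (x : ℂ) • f x) ∈ μ.preL2),
    p = (μ.toL2v f hf, μ.toL2v (fun x : ℝ => (x : ℂ) • f x) hg)}
  zero_mem' := by
    have h : (fun x : ℝ => (x : ℂ) • (0 : ℝ → Fin N → ℂ) x) = 0 := by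
      funext x
      simp
    refine ⟨0, μ.preL2.zero_mem, by rw [h]; exact μ.preL2.zero_mem, ?_⟩
    simp only [h]
    rfl
  add_mem' := by
    rintro _ _ ⟨f, hf, hf', rfl⟩ ⟨g, hg, hg', rfl⟩
    have h : (fun x : ℝ => (x : ℂ) • (f + g) x)
        = (fun x : ℝ => (x : ℂ) • f x) + fun x : ℝ => (x : ℂ) • g x := by
      funext x
      simp
    refine ⟨f + g, μ.preL2.add_mem hf hg, by rw [h]; exact μ.preL2.add_mem hf' hg', ?_⟩
    simp only [h]
    rfl
  smul_mem' := by
    rintro c _ ⟨f, hf, hf', rfl⟩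
    have h : (fun x : ℝ => (x : ℂ) • (c • f) x) = c • fun x : ℝ => (x : ℂ) • f x := by
      funext x
      simp [smul_comm c]
    refine ⟨c • f, μ.preL2.smul_mem c hf, by rw [h]; exact μ.preL2.smul_mem c hf', ?_⟩
    simp only [h]
    rfl

/-- The graph is single-valued. -/
theorem mulVarGraph_functional {p : μ.L2v × μ.L2v} (hp : p ∈ μ.mulVarGraph) (h0 : p.1 = 0) :
    p.2 = 0 := by
  obtain ⟨f, hf, hg, rfl⟩ := hp
  have h1 : ∫ x, μ.form f f x ∂μ.traceMeasure = 0 := by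
    rw [← μ.inner_toL2v hf hf]
    simp only at h0
    rw [h0, inner_zero_left]
  have h2 : ∫ x, (μ.form f f x).re ∂μ.traceMeasure = 0 := by
    have := integral_re (μ.integrable_form ⟨f, hf⟩ ⟨f, hf⟩)
    simp only [RCLike.re_eq_complex_re] at this
    rw [this, h1, Complex.zero_re]
  rw [integral_eq_zero_iff_of_nonneg_ae] at h2
  · refine (inner_self_eq_zero (𝕜 := ℂ)).1 ?_
    simp only
    rw [μ.inner_toL2v hg hg]
    refine integral_eq_zero_of_ae ?_
    filter_upwards [h2, μ.form_self_nonneg f] with x hx hx'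
    have h3 : μ.form f f x = 0 := Complex.ext hx (Complex.nonneg_iff.1 hx').2.symm
    have h4 : μ.form (fun x : ℝ => (x : ℂ) • f x) (fun x : ℝ => (x : ℂ) • f x) x
        = star (x : ℂ) * ((x : ℂ) * μ.form f f x) := by
      simp [form, star_smul, smul_dotProduct, mulVec_smul, dotProduct_smul]
    rw [h4, h3]
    simp
  · filter_upwards [μ.form_self_nonneg f] with x hx
    exact (Complex.nonneg_iff.1 hx).1
  · exact (μ.integrable_form ⟨f, hf⟩ ⟨f, hf⟩).re

/-- Multiplication by the variable on `L²_v(μ)`, with its maximal domain. -/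
def mulVar : μ.L2v →ₗ.[ℂ] μ.L2v := μ.mulVarGraph.toLinearPMap

theorem mulVar_graph : μ.mulVar.graph = μ.mulVarGraph :=
  Submodule.toLinearPMap_graph_eq _ fun _ hp h0 => μ.mulVarGraph_functional hp h0

/-! ### Orthonormal polynomials and recurrence coefficients -/

/-- The value `P(x)` of a matrix polynomial `P(z) = ∑ A_k z^k` at a real point. -/
def _root_.Polynomial.evalReal (p : Polynomial (Matrix (Fin N) (Fin N) ℂ)) (x : ℝ) :
    Matrix (Fin N) (Fin N) ℂ :=
  p.eval (Matrix.scalar (Fin N) (x : ℂ))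

/-- The matrix `∫_B p(x) P(x) W(x) Q^*(x) dτ_μ(x)`, entrywise; here `Q^*(x) = Q(x)^*` as `x` is
real. -/
def matIntegral (B : Set ℝ) (p : ℝ → ℂ) (P Q : Polynomial (Matrix (Fin N) (Fin N) ℂ)) :
    Matrix (Fin N) (Fin N) ℂ :=
  Matrix.of fun i j =>
    ∫ x in B, p x * (P.evalReal x * μ.weight x * (Q.evalReal x)ᴴ) i j ∂μ.traceMeasure

/-- `(P_n)` is a sequence of orthonormal matrix polynomials for `μ`: `P_n` has degree `n` and
regular leading coefficient, and `∫ P_n W P_m^* dτ_μ = δ_{n,m} I`. -/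
structure IsOrthonormalSeq (P : ℕ → Polynomial (Matrix (Fin N) (Fin N) ℂ)) : Prop where
  natDegree : ∀ n, (P n).natDegree = n
  isUnit_leadingCoeff : ∀ n, IsUnit (P n).leadingCoeff
  orthonormal : ∀ n m, μ.matIntegral Set.univ (fun _ => 1) (P n) (P m) = if n = m then 1 else 0

/-- `A_n = ∫ x P_n W P_{n+1}^* dτ_μ`. -/
def coeffA (P : ℕ → Polynomial (Matrix (Fin N) (Fin N) ℂ)) (n : ℕ) : Matrix (Fin N) (Fin N) ℂ :=
  μ.matIntegral Set.univ (fun x => (x : ℂ)) (P n) (P (n + 1))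

/-- `B_n = ∫ x P_n W P_n^* dτ_μ`. -/
def coeffB (P : ℕ → Polynomial (Matrix (Fin N) (Fin N) ℂ)) (n : ℕ) : Matrix (Fin N) (Fin N) ℂ :=
  μ.matIntegral Set.univ (fun x => (x : ℂ)) (P n) (P n)

end MatrixMeasure

/-! ### The block Jacobi operator -/

/-- `ℓ²(ℂ^N)`: square-summable sequences `V = ∑ e_n ⊗ v_n` in `ℂ^N`. -/
abbrev BlockEll2 (N : ℕ) : Type := lp (fun _ : ℕ => EuclideanSpace ℂ (Fin N)) 2

/-- The action of the block tridiagonal matrix on an arbitrary sequence. -/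
def blockJacobiSeq {N : ℕ} (A B : ℕ → Matrix (Fin N) (Fin N) ℂ)
    (v : ℕ → EuclideanSpace ℂ (Fin N)) : ℕ → EuclideanSpace ℂ (Fin N)
  | 0 => (A 0).toEuclideanLin (v 1) + (B 0).toEuclideanLin (v 0)
  | n + 1 => (A (n + 1)).toEuclideanLin (v (n + 2)) + (B (n + 1)).toEuclideanLin (v (n + 1))
      + (A n)ᴴ.toEuclideanLin (v n)

/-- The finitely supported elements of `ℓ²(ℂ^N)`. -/
def finiteVectors (N : ℕ) : Submodule ℂ (BlockEll2 N) where
  carrier := {V | ∃ M : ℕ, ∀ n, M ≤ n → V n = 0}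
  zero_mem' := ⟨0, fun _ _ => rfl⟩
  add_mem' := by
    rintro V V' ⟨M, hM⟩ ⟨M', hM'⟩
    refine ⟨max M M', fun n hn => ?_⟩
    rw [lp.coeFn_add, Pi.add_apply, hM n (le_of_max_le_left hn), hM' n (le_of_max_le_right hn),
      add_zero]
  smul_mem' := by
    rintro c V ⟨M, hM⟩
    refine ⟨M, fun n hn => ?_⟩
    rw [lp.coeFn_smul, Pi.smul_apply, hM n hn, smul_zero]

theorem memℓp_blockJacobiSeq {N : ℕ} (A B : ℕ → Matrix (Fin N) (Fin N) ℂ)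
    (V : finiteVectors N) : Memℓp (blockJacobiSeq A B (V : BlockEll2 N)) 2 := by
  obtain ⟨M, hM⟩ := V.2
  have h0 : Memℓp (blockJacobiSeq A B (V : BlockEll2 N)) 0 := ?_
  · exact h0.of_exponent_ge zero_le
  refine memℓp_zero ?_
  refine (Set.finite_le_nat M).subset fun n hn => ?_
  by_contra h
  apply hn
  simp only [Set.mem_ofPred_eq, not_le] at h
  match n, h with
  | n + 1, h =>
    simp only [blockJacobiSeq]
    rw [hM (n + 2) (by omega), hM (n + 1) (by omega), hM n (by omega)]
    simp

/-- The block Jacobi operator `(J, 𝒟)`, with domain the finitely supported vectors. -/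
def blockJacobi {N : ℕ} (A B : ℕ → Matrix (Fin N) (Fin N) ℂ) : BlockEll2 N →ₗ.[ℂ] BlockEll2 N where
  domain := finiteVectors N
  toFun :=
    { toFun := fun V => ⟨blockJacobiSeq A B (V : BlockEll2 N), memℓp_blockJacobiSeq A B V⟩
      map_add' := by
        intro V V'
        apply lp.ext
        funext n
        rw [lp.coeFn_add, Pi.add_apply]
        cases n <;> simp [blockJacobiSeq] <;> abel
      map_smul' := by
        intro c V
        apply lp.ext
        funext n
        cases n <;> simp [blockJacobiSeq] }

/-! ### Unbounded operators -/

section Spectral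

variable {H : Type*} [NormedAddCommGroup H] [InnerProductSpace ℂ H] [CompleteSpace H]

/-- An operator is essentially self-adjoint if its closure is self-adjoint. -/
def IsEssentiallySelfAdjoint (T : H →ₗ.[ℂ] H) : Prop := IsSelfAdjoint T.closure

variable (H) in
/-- A resolution of the identity on `H`: a projection-valued Borel measure on `ℝ` (with the value
`0` on non-measurable sets, as for Mathlib's vector measures). -/
structure ResolutionOfIdentity where
  /-- the projection `E(B)` -/
  proj : Set ℝ → H →L[ℂ] H
  not_measurable : ∀ B, ¬ MeasurableSet B → proj B = 0
  isSelfAdjoint : ∀ B, MeasurableSet B → IsSelfAdjoint (proj B)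
  proj_inter : ∀ B C, MeasurableSet B → MeasurableSet C → proj (B ∩ C) = proj B * proj C
  proj_empty : proj ∅ = 0
  proj_univ : proj Set.univ = 1
  hasSum : ∀ (u v : H) (B : ℕ → Set ℝ), (∀ i, MeasurableSet (B i)) →
    Pairwise (Function.onFun Disjoint B) →
    HasSum (fun i => inner ℂ v (proj (B i) u)) (inner ℂ v (proj (⋃ i, B i) u))

/-- The complex measure `E_{u,v}(B) = ⟨E(B) u, v⟩` (linear in `u`). -/
def ResolutionOfIdentity.toComplexMeasure (E : ResolutionOfIdentity H) (u v : H) :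
    ComplexMeasure ℝ where
  measureOf' B := inner ℂ v (E.proj B u)
  empty' := by rw [E.proj_empty, _root_.zero_apply, inner_zero_right]
  not_measurable' B hB := by rw [E.not_measurable B hB, _root_.zero_apply, inner_zero_right]
  m_iUnion' B hB hd := E.hasSum u v B hB hd

/-- `T = ∫ t dE(t)`: the domain of `T` consists of the `u` with `∫ t² dE_{u,u}(t) < ∞`, and
`⟨T u, v⟩ = ∫ t dE_{u,v}(t)` (a convergent integral) for `u` in the domain and all `v`. -/
def ResolutionOfIdentity.IsSpectralMeasureOf (E : ResolutionOfIdentity H) (T : H →ₗ.[ℂ] H) :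
    Prop :=
  (∀ u : H, u ∈ T.domain ↔ (E.toComplexMeasure u u).Integrable fun t : ℝ => t ^ 2) ∧
  ∀ (u : T.domain) (v : H), (E.toComplexMeasure u v).Integrable (fun t : ℝ => t) ∧
    inner ℂ v (T u) =
      (E.toComplexMeasure u v).integral (fun t : ℝ => t) (ContinuousLinearMap.lsmul ℝ ℝ)

end Spectral

end

/-!
# Spectral decomposition of essentially self-adjoint block Jacobi operators

Since `W` is positive definite almost everywhere, `f ↦ W^{1/2} f` identifies `L²_v(μ)` with
`L²(τ_μ; ℂ^N)`, so it is complete (`MatrixMeasure.completeSpace_L2v`). Orthonormality then makes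
`V = ∑ e_n ⊗ v_n ↦ ∑ P_n^* v_n` an isometry `MatrixMeasure.seriesIso` of `ℓ²(ℂ^N)` into `L²_v(μ)`.
Expanding `x P_n` in the orthonormal polynomials gives the three-term recurrence, which says that
this isometry carries `J` into multiplication by the variable
(`MatrixMeasure.seriesIso_blockJacobi_mem`).

Essential self-adjointness enters in two places. First, it makes the range of `J + c` dense for
every non-real `c`, so that the range `K` of the isometry is invariant under multiplication by
`(x + c)⁻¹` (`MatrixMeasure.resolvent_mem_range_seriesIso`). By the Stone–Weierstrass theorem on the
circle, transported along the Cayley transform, `K` is invariant under multiplication by all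
compactly supported continuous functions. As `K` contains the constants, a function orthogonal to
`K` vanishes (`MatrixMeasure.eq_top_of_resolvent_invariant`), so the isometry is onto: no
determinacy of the moment problem is needed. Second, the adjoint of `J` is then symmetric, and a
symmetric operator has no non-real eigenvalue, which together with the resolvent of multiplication
by the variable identifies the two domains (`MatrixMeasure.mem_adjoint_graph_iff`).

The spectral resolution is `E(B) = U⁻¹ χ_B U`; its complex measures `E_{u,v}` have the densities
`(U v)^* W (U u)` with respect to `τ_μ`, and the integrals against them are computed in
`MeasureTheory.integral_withDensityᵥ`.
-/

noncomputable section

/-! ### Essentially self-adjoint operators -/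

/-- A symmetric operator has no non-real eigenvalue. -/
theorem LinearPMap.IsFormalAdjoint.eq_zero_of_eq_smul {H : Type*}
    [NormedAddCommGroup H] [InnerProductSpace ℂ H] {A : H →ₗ.[ℂ] H} (hA : A.IsFormalAdjoint A)
    {c : ℂ} (hc : c.im ≠ 0) (y : A.domain) (hy : A y = c • (y : H)) : (y : H) = 0 := by
  have h1 := hA y y
  rw [hy, inner_smul_left, inner_smul_right] at h1
  have h2 : (starRingEnd ℂ c - c) * inner ℂ (y : H) (y : H) = 0 := by
    rw [sub_mul, h1, sub_self]
  rcases mul_eq_zero.1 h2 with h3 | h3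
  · exact absurd (Complex.conj_eq_iff_im.1 (sub_eq_zero.1 h3)) hc
  · exact inner_self_eq_zero.1 h3

section EssentiallySelfAdjoint

variable {H : Type*} [NormedAddCommGroup H] [InnerProductSpace ℂ H] [CompleteSpace H]

theorem LinearPMap.adjoint_le_adjoint_of_le {S T : H →ₗ.[ℂ] H} (hS : Dense (S.domain : Set H))
    (hT : Dense (T.domain : Set H)) (h : S ≤ T) : T† ≤ S† := by
  refine LinearPMap.IsFormalAdjoint.le_adjoint hS fun x y => ?_
  have h1 : S x = T ⟨x, h.1 x.2⟩ := h.2 rfl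
  rw [h1]
  exact (LinearPMap.adjoint_isFormalAdjoint hT).symm ⟨x, h.1 x.2⟩ y

/-- The closure of an essentially self-adjoint operator is its adjoint. -/
theorem IsEssentiallySelfAdjoint.closure_eq_adjoint {T : H →ₗ.[ℂ] H}
    (h : IsEssentiallySelfAdjoint T) (hT : Dense (T.domain : Set H)) : T.closure = T† := by
  have hadj : T.closure† = T.closure := LinearPMap.isSelfAdjoint_def.1 h
  have hle : T.closure ≤ T† := by
    conv_lhs => rw [← hadj]
    exact LinearPMap.adjoint_le_adjoint_of_le hT h.dense_domain T.le_closure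
  have hcl : T.IsClosable :=
    (LinearPMap.adjoint_isClosed hT).isClosable.leIsClosable (T.le_closure.trans hle)
  refine le_antisymm hle ?_
  conv_rhs => rw [← hadj]
  refine LinearPMap.IsFormalAdjoint.le_adjoint h.dense_domain fun x y => ?_
  -- the defining identity of the adjoint passes from the graph of `T` to its closure
  have hx : ((x : H), T.closure x) ∈ _root_.closure (T.graph : Set (H × H)) := by
    have := T.closure.mem_graph x
    rw [← hcl.graph_closure_eq_closure_graph] at this
    exact this
  have hc : IsClosed {p : H × H | inner ℂ p.2 (y : H) = inner ℂ p.1 (T† y)} :=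
    isClosed_eq (by fun_prop) (by fun_prop)
  refine closure_minimal ?_ hc hx
  rintro p hp
  obtain ⟨z, hz1, hz2⟩ := (LinearPMap.mem_graph_iff T).1 hp
  rw [Set.mem_ofPred_eq, ← hz1, ← hz2]
  exact (LinearPMap.adjoint_isFormalAdjoint hT).symm z y

/-- The adjoint of an essentially self-adjoint operator is symmetric. -/
theorem IsEssentiallySelfAdjoint.adjoint_symmetric {T : H →ₗ.[ℂ] H}
    (h : IsEssentiallySelfAdjoint T) (hT : Dense (T.domain : Set H)) :
    (T†).IsFormalAdjoint (T†) := by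
  rw [← h.closure_eq_adjoint hT]
  have := LinearPMap.adjoint_isFormalAdjoint h.dense_domain
  rwa [LinearPMap.isSelfAdjoint_def.1 h] at this

/-- For an essentially self-adjoint operator `T` and non-real `c`, the range of `T + c` is
dense. -/
theorem IsEssentiallySelfAdjoint.range_add_smul_dense {T : H →ₗ.[ℂ] H}
    (h : IsEssentiallySelfAdjoint T) (hT : Dense (T.domain : Set H)) {c : ℂ} (hc : c.im ≠ 0) :
    (LinearMap.range (T.toFun + c • T.domain.subtype)).topologicalClosure = ⊤ := by
  rw [Submodule.topologicalClosure_eq_top_iff, Submodule.eq_bot_iff]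
  intro y hy
  rw [Submodule.mem_orthogonal'] at hy
  have hy' : ∀ x : T.domain, inner ℂ (-(starRingEnd ℂ c) • y) (x : H) = inner ℂ y (T x) := by
    intro x
    have h1 := hy _ ⟨x, rfl⟩
    have h2 : inner ℂ y (T x) + c * inner ℂ y (x : H) = 0 := by
      rw [← inner_smul_right, ← inner_add_right]
      exact h1
    rw [inner_smul_left, map_neg, Complex.conj_conj]
    linear_combination -h2
  -- a vector orthogonal to the range is an eigenvector of the symmetric operator `T†`
  have hmem : y ∈ T†.domain := LinearPMap.mem_adjoint_domain_of_exists _ ⟨_, hy'⟩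
  refine (h.adjoint_symmetric hT).eq_zero_of_eq_smul (c := -(starRingEnd ℂ c)) (by simpa using hc)
    ⟨y, hmem⟩ ?_
  exact LinearPMap.adjoint_apply_eq hT ⟨y, hmem⟩ hy'

end EssentiallySelfAdjoint

/-! ### Integrals against a complex measure with a density -/

section VectorDensity

variable {X E : Type*} {mX : MeasurableSpace X} [NormedAddCommGroup E] [NormedSpace ℝ E]
  [CompleteSpace E] {τ : Measure X} {F : X → E} {f : X → ℝ}

theorem MeasureTheory.integrable_withDensityᵥ_iff (hF : Integrable F τ) (hf : Measurable f) :
    (τ.withDensityᵥ F).Integrable f ↔ Integrable (fun x => f x • F x) τ := by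
  have hFe : AEMeasurable (fun x => ‖F x‖ₑ) τ := hF.aestronglyMeasurable.enorm
  rw [VectorMeasure.Integrable, Measure.variation_withDensityᵥ hF]
  rw [integrable_withDensity_iff_integrable_smul₀' hFe (by simp)]
  rw [← integrable_norm_iff, ← integrable_norm_iff (f := fun x => f x • F x)]
  · simp [norm_smul, mul_comm]
  · exact hf.aestronglyMeasurable.smul hF.aestronglyMeasurable
  · exact hFe.ennreal_toReal.aestronglyMeasurable.smul hf.aestronglyMeasurable

/-- Integrals of scalar functions against `F dτ`, by approximation with simple functions. -/
theorem MeasureTheory.integral_withDensityᵥ (hF : Integrable F τ) (hf : Measurable f)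
    (h : (τ.withDensityᵥ F).Integrable f) :
    (τ.withDensityᵥ F).integral f (ContinuousLinearMap.lsmul ℝ ℝ) = ∫ x, f x • F x ∂τ := by
  have hfin : IsFiniteMeasure (τ.withDensityᵥ F).variation := by
    rw [Measure.variation_withDensityᵥ hF]
    exact isFiniteMeasure_withDensity hF.2.ne
  have hint : ∀ s : SimpleFunc X ℝ, Integrable (fun x => s x • F x) τ := fun s => by
    obtain ⟨C, hC⟩ := s.exists_forall_norm_le
    exact hF.bdd_smul C s.aestronglyMeasurable (Filter.Eventually.of_forall hC)
  have hsimple : ∀ s : SimpleFunc X ℝ, (τ.withDensityᵥ F).integral s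
      (ContinuousLinearMap.lsmul ℝ ℝ) = ∫ x, s x • F x ∂τ := by
    intro s
    induction s using SimpleFunc.induction with
    | const c hs =>
      rename_i s
      have h1 : ⇑(SimpleFunc.piecewise s hs (SimpleFunc.const X c) (SimpleFunc.const X 0))
          = s.indicator fun _ => c := by
        ext x
        simp [Set.indicator, Set.piecewise]
      have h2 : (fun x => (s.indicator (fun _ => c) x : ℝ) • F x)
          = s.indicator fun x => c • F x := by
        ext x
        by_cases hx : x ∈ s <;> simp [hx]
      rw [h1, VectorMeasure.integral_indicator_const _ hs, h2, integral_indicator hs,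
        integral_smul, withDensityᵥ_apply hF hs]
      rfl
    | add hd hs ht =>
      rename_i s t
      rw [SimpleFunc.coe_add, VectorMeasure.integral_add (SimpleFunc.integrable_of_isFiniteMeasure s)
        (SimpleFunc.integrable_of_isFiniteMeasure t), hs, ht, ← integral_add (hint s) (hint t)]
      simp [add_smul]
  have happ : ∀ x, Filter.Tendsto
      (fun n => SimpleFunc.approxOn f hf Set.univ 0 (Set.mem_univ 0) n x) Filter.atTop
      (nhds (f x)) := fun x => SimpleFunc.tendsto_approxOn hf _ (by simp)
  have hbd : ∀ n x, ‖SimpleFunc.approxOn f hf Set.univ 0 (Set.mem_univ 0) n x‖ ≤ 2 * ‖f x‖ :=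
    fun n x => (SimpleFunc.norm_approxOn_zero_le hf _ x n).trans_eq (two_mul _).symm
  have h1 : Filter.Tendsto (fun n => (τ.withDensityᵥ F).integral
      (SimpleFunc.approxOn f hf Set.univ 0 (Set.mem_univ 0) n) (ContinuousLinearMap.lsmul ℝ ℝ))
      Filter.atTop (nhds ((τ.withDensityᵥ F).integral f (ContinuousLinearMap.lsmul ℝ ℝ))) :=
    VectorMeasure.tendsto_integral_of_dominated_convergence
    (fun x => 2 * ‖f x‖) (fun n => SimpleFunc.aestronglyMeasurable _) (h.norm.const_mul 2)
    (fun n => Filter.Eventually.of_forall (hbd n)) (Filter.Eventually.of_forall happ)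
  have h2 : Filter.Tendsto
      (fun n => ∫ x, SimpleFunc.approxOn f hf Set.univ 0 (Set.mem_univ 0) n x • F x ∂τ)
      Filter.atTop (nhds (∫ x, f x • F x ∂τ)) :=
    MeasureTheory.tendsto_integral_of_dominated_convergence
    (fun x => 2 * ‖f x • F x‖) (fun n => (hint _).aestronglyMeasurable)
    (((integrable_withDensityᵥ_iff hF hf).1 h).norm.const_mul 2)
    (fun n => Filter.Eventually.of_forall fun x => by
      rw [norm_smul, norm_smul, ← mul_assoc]
      exact mul_le_mul_of_nonneg_right (hbd n x) (norm_nonneg _))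
    (Filter.Eventually.of_forall fun x => (happ x).smul_const _)
  exact tendsto_nhds_unique h1 (h2.congr fun n => (hsimple _).symm)

end VectorDensity

/-! ### Completeness of `L²_v(μ)` -/

section MatrixSqrt

open scoped Matrix.Norms.L2Operator MatrixOrder

/-- A square root of positive semi-definite matrices that is continuous on all matrices: the
positive square root of `|A| = (A^* A)^{1/2}`. Continuity without restriction on `A` makes the
square root of a measurable matrix function measurable. -/
def Matrix.absSqrt {N : ℕ} (A : Matrix (Fin N) (Fin N) ℂ) : Matrix (Fin N) (Fin N) ℂ :=
  CFC.sqrt (CFC.sqrt (star A * A))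

theorem Matrix.continuous_absSqrt (N : ℕ) :
    Continuous (Matrix.absSqrt : Matrix (Fin N) (Fin N) ℂ → Matrix (Fin N) (Fin N) ℂ) := by
  have key : ∀ g : Matrix (Fin N) (Fin N) ℂ → Matrix (Fin N) (Fin N) ℂ, Continuous g →
      (∀ A, 0 ≤ g A) → Continuous fun A => CFC.sqrt (g A) := by
    intro g hg hg0
    simp_rw [CFC.sqrt_eq_cfc]
    exact Continuous.cfc_nnreal_of_mem_nhdsSet (s := Set.univ) NNReal.sqrt (by simp) hg hg0
      NNReal.continuous_sqrt.continuousOn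
  exact key _ (key _ (by fun_prop) fun A => star_mul_self_nonneg A) fun A => CFC.sqrt_nonneg _

theorem Matrix.isHermitian_absSqrt {N : ℕ} (A : Matrix (Fin N) (Fin N) ℂ) :
    A.absSqrt.IsHermitian :=
  (Matrix.nonneg_iff_posSemidef.1 (CFC.sqrt_nonneg _)).isHermitian

theorem Matrix.PosSemidef.absSqrt_mul_self {N : ℕ} {A : Matrix (Fin N) (Fin N) ℂ}
    (hA : A.PosSemidef) : A.absSqrt * A.absSqrt = A := by
  rw [Matrix.absSqrt, CFC.sqrt_mul_sqrt_self _ (CFC.sqrt_nonneg _)]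
  exact CFC.abs_of_nonneg A (Matrix.nonneg_iff_posSemidef.2 hA)

end MatrixSqrt

theorem Matrix.measurable_absSqrt_comp {N : ℕ} {X : Type*} [MeasurableSpace X]
    {w : X → Matrix (Fin N) (Fin N) ℂ} (hw : ∀ i j, Measurable fun x => w x i j) (i j : Fin N) :
    Measurable fun x => (w x).absSqrt i j := by
  have h1 : Measurable fun x => (fun i j => w x i j : Fin N → Fin N → ℂ) :=
    measurable_pi_lambda _ fun i => measurable_pi_lambda _ fun j => hw i j
  have h2 : Continuous fun A : Fin N → Fin N → ℂ => (Matrix.absSqrt (Matrix.of A)) i j :=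
    ((Matrix.continuous_absSqrt N).comp continuous_id).matrix_elem i j
  exact h2.measurable.comp h1

theorem Matrix.measurable_inv_entry {N : ℕ} {X : Type*} [MeasurableSpace X]
    {w : X → Matrix (Fin N) (Fin N) ℂ} (hw : ∀ i j, Measurable fun x => w x i j) (i j : Fin N) :
    Measurable fun x => (w x)⁻¹ i j := by
  have h1 : Measurable fun x => (fun i j => w x i j : Fin N → Fin N → ℂ) :=
    measurable_pi_lambda _ fun i => measurable_pi_lambda _ fun j => hw i j
  have h2 : Continuous fun A : Fin N → Fin N → ℂ => (Matrix.of A).det :=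
    Continuous.matrix_det (A := fun A : Fin N → Fin N → ℂ => Matrix.of A) continuous_id
  have h3 : Continuous fun A : Fin N → Fin N → ℂ => (Matrix.of A).adjugate i j :=
    (Continuous.matrix_adjugate (A := fun A : Fin N → Fin N → ℂ => Matrix.of A)
      continuous_id).matrix_elem i j
  have h4 : (fun x => (w x)⁻¹ i j) = fun x => ((w x).det)⁻¹ * (w x).adjugate i j := by
    funext x
    rw [Matrix.inv_def, Matrix.smul_apply, Ring.inverse_eq_inv', smul_eq_mul]
  rw [h4]
  exact (h2.measurable.comp h1).inv.mul (h3.measurable.comp h1)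

theorem Matrix.measurable_mulVec {N : ℕ} {X : Type*} [MeasurableSpace X]
    {w : X → Matrix (Fin N) (Fin N) ℂ} (hw : ∀ i j, Measurable fun x => w x i j)
    {f : X → Fin N → ℂ} (hf : Measurable f) : Measurable fun x => w x *ᵥ f x := by
  refine measurable_pi_lambda _ fun i => ?_
  simp only [mulVec, dotProduct]
  exact Finset.measurable_fun_sum _ fun j _ => (hw i j).mul ((measurable_pi_apply j).comp hf)

namespace MatrixMeasure

variable {N : ℕ} (μ : MatrixMeasure N)

theorem toL2v_sub {f g : ℝ → Fin N → ℂ} (hf : f ∈ μ.preL2) (hg : g ∈ μ.preL2) :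
    μ.toL2v f hf - μ.toL2v g hg = μ.toL2v (f - g) (μ.preL2.sub_mem hf hg) := rfl

theorem toL2v_add {f g : ℝ → Fin N → ℂ} (hf : f ∈ μ.preL2) (hg : g ∈ μ.preL2) :
    μ.toL2v f hf + μ.toL2v g hg = μ.toL2v (f + g) (μ.preL2.add_mem hf hg) := rfl

theorem smul_toL2v {f : ℝ → Fin N → ℂ} (c : ℂ) (hf : f ∈ μ.preL2) :
    c • μ.toL2v f hf = μ.toL2v (c • f) (μ.preL2.smul_mem c hf) := rfl

theorem exists_toL2v (u : μ.L2v) : ∃ (f : ℝ → Fin N → ℂ) (hf : f ∈ μ.preL2), u = μ.toL2v f hf := by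
  obtain ⟨⟨f, hf⟩, rfl⟩ := SeparationQuotient.surjective_mk u
  exact ⟨f, hf, rfl⟩

theorem norm_sq_toL2v {f : ℝ → Fin N → ℂ} (hf : f ∈ μ.preL2) :
    ‖μ.toL2v f hf‖ ^ 2 = ∫ x, (μ.form f f x).re ∂μ.traceMeasure := by
  rw [← inner_self_eq_norm_sq (𝕜 := ℂ), inner_toL2v]
  exact (integral_re (μ.integrable_form ⟨f, hf⟩ ⟨f, hf⟩)).symm

theorem toL2v_eq_of_ae {f g : ℝ → Fin N → ℂ} (hf : f ∈ μ.preL2) (hg : g ∈ μ.preL2)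
    (h : f =ᵐ[μ.traceMeasure] g) : μ.toL2v f hf = μ.toL2v g hg := by
  rw [← sub_eq_zero, toL2v_sub, ← norm_eq_zero, ← sq_eq_zero_iff, norm_sq_toL2v]
  refine integral_eq_zero_of_ae ?_
  filter_upwards [h] with x hx
  simp [form, hx]

/-- The measurable square root `S = W^{1/2}` of the density. -/
def weightSqrt (x : ℝ) : Matrix (Fin N) (Fin N) ℂ := (μ.weight x).absSqrt

theorem form_eq_weightSqrt : ∀ᵐ x ∂μ.traceMeasure, ∀ f g : ℝ → Fin N → ℂ,
    μ.form f g x = star (μ.weightSqrt x *ᵥ f x) ⬝ᵥ (μ.weightSqrt x *ᵥ g x) := by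
  filter_upwards [μ.weight_posSemidef] with x hx f g
  have h := hx.absSqrt_mul_self
  rw [star_mulVec, ← dotProduct_mulVec, mulVec_mulVec]
  rw [weightSqrt, (isHermitian_absSqrt _).eq, h, form]

theorem isUnit_weightSqrt (hμ : μ.IsAdmissible) :
    ∀ᵐ x ∂μ.traceMeasure, IsUnit (μ.weightSqrt x).det := by
  filter_upwards [hμ.posDef_weight] with x hx
  have h := hx.posSemidef.absSqrt_mul_self
  have h2 : IsUnit ((μ.weight x).absSqrt * (μ.weight x).absSqrt).det := by
    rw [h]
    exact (Matrix.isUnit_iff_isUnit_det _).1 hx.isUnit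
  rw [det_mul] at h2
  exact isUnit_of_mul_isUnit_left h2

/-- If `W` is positive definite almost everywhere, then `g ↦ W^{-1/2} g` maps
`L²(τ_μ; ℂ^N)` isometrically onto `L²_v(μ)`, so that the latter is complete. -/
theorem completeSpace_L2v (hμ : μ.IsAdmissible) : CompleteSpace μ.L2v := by
  set R : ℝ → Matrix (Fin N) (Fin N) ℂ := fun x => (μ.weightSqrt x)⁻¹ with hR
  have hSm : ∀ i j, Measurable fun x => μ.weightSqrt x i j :=
    Matrix.measurable_absSqrt_comp μ.measurable_weight
  have hRm : ∀ i j, Measurable fun x => R x i j := Matrix.measurable_inv_entry hSm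
  let E := EuclideanSpace ℂ (Fin N)
  have hrep : ∀ g : Lp E 2 μ.traceMeasure, Measurable fun x => R x *ᵥ (g x).ofLp := fun g =>
    Matrix.measurable_mulVec hRm
      ((PiLp.continuous_ofLp 2 _).measurable.comp (Lp.stronglyMeasurable g).measurable)
  have hform : ∀ g h : Lp E 2 μ.traceMeasure,
      μ.form (fun x => R x *ᵥ (g x).ofLp) (fun x => R x *ᵥ (h x).ofLp)
        =ᵐ[μ.traceMeasure] fun x => inner ℂ (g x) (h x) := by
    intro g h
    filter_upwards [μ.form_eq_weightSqrt, μ.isUnit_weightSqrt hμ] with x hx hu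
    rw [hx, mulVec_mulVec, mulVec_mulVec, Matrix.mul_nonsing_inv _ hu, one_mulVec, one_mulVec,
      EuclideanSpace.inner_eq_star_dotProduct, dotProduct_comm]
  have hmem : ∀ g : Lp E 2 μ.traceMeasure, (fun x => R x *ᵥ (g x).ofLp) ∈ μ.preL2 := fun g =>
    ⟨hrep g, (L2.integrable_inner (𝕜 := ℂ) g g).congr (hform g g).symm⟩
  let Ψ : Lp E 2 μ.traceMeasure → μ.L2v := fun g => μ.toL2v _ (hmem g)
  have hinner : ∀ g h, inner ℂ (Ψ g) (Ψ h) = inner ℂ g h := fun g h => by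
    rw [inner_toL2v, L2.inner_def]
    exact integral_congr_ae (hform g h)
  have hiso : Isometry Ψ := by
    refine Isometry.of_dist_eq fun g h => ?_
    rw [dist_eq_norm, dist_eq_norm, ← sq_eq_sq₀ (norm_nonneg _) (norm_nonneg _),
      @norm_sub_sq ℂ, @norm_sub_sq ℂ, hinner, ← inner_self_eq_norm_sq (𝕜 := ℂ),
      ← inner_self_eq_norm_sq (𝕜 := ℂ), ← inner_self_eq_norm_sq (𝕜 := ℂ),
      ← inner_self_eq_norm_sq (𝕜 := ℂ), hinner, hinner]
  have hsurj : Function.Surjective Ψ := by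
    intro u
    obtain ⟨f, hf, rfl⟩ := μ.exists_toL2v u
    have hm : Measurable fun x => (WithLp.toLp 2 (μ.weightSqrt x *ᵥ f x) : E) :=
      (PiLp.continuous_toLp 2 _).measurable.comp (Matrix.measurable_mulVec hSm hf.1)
    have hL : MemLp (fun x => (WithLp.toLp 2 (μ.weightSqrt x *ᵥ f x) : E)) 2 μ.traceMeasure := by
      rw [memLp_two_iff_integrable_sq_norm hm.aestronglyMeasurable]
      refine hf.2.re.congr ?_
      filter_upwards [μ.form_eq_weightSqrt] with x hx
      rw [← inner_self_eq_norm_sq (𝕜 := ℂ), EuclideanSpace.inner_eq_star_dotProduct, hx,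
        dotProduct_comm]
    refine ⟨hL.toLp _, μ.toL2v_eq_of_ae _ _ ?_⟩
    filter_upwards [hL.coeFn_toLp, μ.isUnit_weightSqrt hμ] with x hx hu
    rw [hx, mulVec_mulVec, Matrix.nonsing_inv_mul _ hu, one_mulVec]
  exact (hiso.isUniformInducing.completeSpace_congr hsurj).1 inferInstance

end MatrixMeasure

/-! ### Multiplication by bounded functions -/

/-- Bounded Borel functions on the line. -/
structure IsBddMeasurable (φ : ℝ → ℂ) : Prop where
  measurable : Measurable φ
  bounded : ∃ C, ∀ x, ‖φ x‖ ≤ C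

namespace IsBddMeasurable

theorem const (c : ℂ) : IsBddMeasurable fun _ => c := ⟨measurable_const, ‖c‖, fun _ => le_rfl⟩

theorem add {φ ψ : ℝ → ℂ} (hφ : IsBddMeasurable φ) (hψ : IsBddMeasurable ψ) :
    IsBddMeasurable fun x => φ x + ψ x := by
  obtain ⟨C, hC⟩ := hφ.bounded
  obtain ⟨D, hD⟩ := hψ.bounded
  exact ⟨hφ.measurable.add hψ.measurable, C + D,
    fun x => (norm_add_le _ _).trans (add_le_add (hC x) (hD x))⟩

theorem mul {φ ψ : ℝ → ℂ} (hφ : IsBddMeasurable φ) (hψ : IsBddMeasurable ψ) :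
    IsBddMeasurable fun x => φ x * ψ x := by
  obtain ⟨C, hC⟩ := hφ.bounded
  obtain ⟨D, hD⟩ := hψ.bounded
  refine ⟨hφ.measurable.mul hψ.measurable, C * D, fun x => ?_⟩
  rw [norm_mul]
  exact mul_le_mul (hC x) (hD x) (norm_nonneg _) ((norm_nonneg _).trans (hC x))

theorem indicator {B : Set ℝ} (hB : MeasurableSet B) :
    IsBddMeasurable (B.indicator fun _ => 1) :=
  ⟨measurable_const.indicator hB, 1, fun x => by by_cases h : x ∈ B <;> simp [h]⟩

/-- The resolvent function `x ↦ (x + c)⁻¹` for non-real `c`. -/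
theorem resolvent {c : ℂ} (hc : c.im ≠ 0) : IsBddMeasurable fun x => ((x : ℂ) + c)⁻¹ := by
  refine ⟨by fun_prop, |c.im|⁻¹, fun x => ?_⟩
  rw [norm_inv]
  refine inv_anti₀ (abs_pos.2 hc) ?_
  have := Complex.abs_im_le_norm ((x : ℂ) + c)
  simpa using this

end IsBddMeasurable

namespace MatrixMeasure

variable {N : ℕ} (μ : MatrixMeasure N)

theorem form_fun_smul (φ ψ : ℝ → ℂ) (f g : ℝ → Fin N → ℂ) (x : ℝ) :
    μ.form (fun x => φ x • f x) (fun x => ψ x • g x) x = star (φ x) * ψ x * μ.form f g x := by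
  simp [form, star_smul, smul_dotProduct, mulVec_smul, dotProduct_smul]
  ring

theorem bdd_smul_mem_preL2 {φ : ℝ → ℂ} (hφ : IsBddMeasurable φ) {f : ℝ → Fin N → ℂ}
    (hf : f ∈ μ.preL2) : (fun x => φ x • f x) ∈ μ.preL2 := by
  refine ⟨hφ.measurable.smul hf.1, ?_⟩
  obtain ⟨C, hC⟩ := hφ.bounded
  have h : μ.form (fun x => φ x • f x) (fun x => φ x • f x)
      = fun x => (star (φ x) * φ x) * μ.form f f x := by
    funext x
    exact μ.form_fun_smul φ φ f f x
  rw [h]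
  refine hf.2.bdd_mul (c := C * C) ?_ (Filter.Eventually.of_forall fun x => ?_)
  · exact ((Complex.continuous_conj.measurable.comp hφ.measurable).mul
      hφ.measurable).aestronglyMeasurable
  · rw [norm_mul, norm_star]
    exact mul_le_mul (hC x) (hC x) (norm_nonneg _) ((norm_nonneg _).trans (hC x))

theorem norm_bdd_smul_le {φ : ℝ → ℂ} (hφ : IsBddMeasurable φ) {C : ℝ} (hC : ∀ x, ‖φ x‖ ≤ C)
    {f : ℝ → Fin N → ℂ} (hf : f ∈ μ.preL2) :
    ‖μ.toL2v _ (μ.bdd_smul_mem_preL2 hφ hf)‖ ≤ C * ‖μ.toL2v f hf‖ := by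
  have hC0 : 0 ≤ C := (norm_nonneg _).trans (hC 0)
  rw [← sq_le_sq₀ (norm_nonneg _) (by positivity), mul_pow, norm_sq_toL2v, norm_sq_toL2v,
    ← integral_const_mul]
  refine integral_mono_ae (μ.bdd_smul_mem_preL2 hφ hf).2.re (hf.2.re.const_mul _) ?_
  filter_upwards [μ.form_self_nonneg f] with x hx
  have h1 : (star (φ x) * φ x * μ.form f f x).re = ‖φ x‖ ^ 2 * (μ.form f f x).re := by
    have : star (φ x) * φ x = ((‖φ x‖ ^ 2 : ℝ) : ℂ) := by
      rw [Complex.star_def, ← Complex.normSq_eq_conj_mul_self, Complex.normSq_eq_norm_sq]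
    rw [this, Complex.re_ofReal_mul]
  simp only [form_fun_smul]
  rw [h1]
  exact mul_le_mul_of_nonneg_right (pow_le_pow_left₀ (norm_nonneg _) (hC x) 2)
    (Complex.nonneg_iff.1 hx).1

/-- Multiplication by a bounded Borel function on `𝓛²_v(μ)`. -/
def preMulBdd {φ : ℝ → ℂ} (hφ : IsBddMeasurable φ) : μ.PreL2v →ₗ[ℂ] μ.PreL2v where
  toFun f := ⟨fun x => φ x • f.fn x, μ.bdd_smul_mem_preL2 hφ f.2⟩
  map_add' f g := Subtype.ext <| funext fun x => smul_add (φ x) (f.fn x) (g.fn x)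
  map_smul' c f := Subtype.ext <| funext fun x => smul_comm (φ x) c (f.fn x)

/-- Multiplication by a bounded Borel function, as a bounded operator on `L²_v(μ)`. -/
def mulBdd {φ : ℝ → ℂ} (hφ : IsBddMeasurable φ) : μ.L2v →L[ℂ] μ.L2v :=
  SeparationQuotient.liftCLM
    ((SeparationQuotient.mkCLM ℂ μ.PreL2v).comp
      ((μ.preMulBdd hφ).mkContinuous hφ.bounded.choose fun f =>
        μ.norm_bdd_smul_le hφ hφ.bounded.choose_spec f.2))
    fun _ _ h => SeparationQuotient.mk_eq_mk.2
      (h.map ((μ.preMulBdd hφ).mkContinuous hφ.bounded.choose fun f =>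
        μ.norm_bdd_smul_le hφ hφ.bounded.choose_spec f.2).continuous)

theorem mulBdd_toL2v {φ : ℝ → ℂ} (hφ : IsBddMeasurable φ) {f : ℝ → Fin N → ℂ}
    (hf : f ∈ μ.preL2) :
    μ.mulBdd hφ (μ.toL2v f hf) = μ.toL2v _ (μ.bdd_smul_mem_preL2 hφ hf) := rfl

theorem norm_mulBdd_le {φ : ℝ → ℂ} (hφ : IsBddMeasurable φ) {C : ℝ} (hC : ∀ x, ‖φ x‖ ≤ C)
    (u : μ.L2v) : ‖μ.mulBdd hφ u‖ ≤ C * ‖u‖ := by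
  obtain ⟨f, hf, rfl⟩ := μ.exists_toL2v u
  exact μ.norm_bdd_smul_le hφ hC hf

theorem mulBdd_add {φ ψ : ℝ → ℂ} (hφ : IsBddMeasurable φ) (hψ : IsBddMeasurable ψ) (u : μ.L2v) :
    μ.mulBdd (hφ.add hψ) u = μ.mulBdd hφ u + μ.mulBdd hψ u := by
  obtain ⟨f, hf, rfl⟩ := μ.exists_toL2v u
  simp only [mulBdd_toL2v, toL2v_add]
  congr 1
  funext x
  exact add_smul _ _ _

theorem mulBdd_mul {φ ψ : ℝ → ℂ} (hφ : IsBddMeasurable φ) (hψ : IsBddMeasurable ψ) (u : μ.L2v) :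
    μ.mulBdd (hφ.mul hψ) u = μ.mulBdd hφ (μ.mulBdd hψ u) := by
  obtain ⟨f, hf, rfl⟩ := μ.exists_toL2v u
  simp only [mulBdd_toL2v]
  congr 1
  funext x
  exact mul_smul _ _ _

theorem mulBdd_const (c : ℂ) (u : μ.L2v) : μ.mulBdd (IsBddMeasurable.const c) u = c • u := by
  obtain ⟨f, hf, rfl⟩ := μ.exists_toL2v u
  rfl

theorem mulBdd_one_add_mul {φ ψ : ℝ → ℂ} (hφ : IsBddMeasurable φ) {c : ℂ}
    (hψ : IsBddMeasurable ψ) (h : ∀ x, ψ x = 1 + c * φ x) (u : μ.L2v) :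
    μ.mulBdd hψ u = u + c • μ.mulBdd hφ u := by
  obtain ⟨f, hf, rfl⟩ := μ.exists_toL2v u
  rw [mulBdd_toL2v, mulBdd_toL2v, smul_toL2v, toL2v_add]
  congr 1
  funext x
  simp [h x, add_smul, mul_smul]

theorem mulBdd_congr {φ ψ : ℝ → ℂ} (hφ : IsBddMeasurable φ) (hψ : IsBddMeasurable ψ)
    (h : ∀ x, φ x = ψ x) : μ.mulBdd hφ = μ.mulBdd hψ := by
  obtain rfl : φ = ψ := funext h
  rfl

theorem inner_mulBdd_right {φ : ℝ → ℂ} (hφ : IsBddMeasurable φ) {f g : ℝ → Fin N → ℂ}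
    (hf : f ∈ μ.preL2) (hg : g ∈ μ.preL2) :
    inner ℂ (μ.toL2v f hf) (μ.mulBdd hφ (μ.toL2v g hg))
      = ∫ x, φ x * μ.form f g x ∂μ.traceMeasure := by
  rw [mulBdd_toL2v, inner_toL2v]
  congr 1
  funext x
  have := μ.form_fun_smul (fun _ => 1) φ f g x
  simpa using this

theorem inner_mulBdd_left {φ : ℝ → ℂ} (hφ : IsBddMeasurable φ) {f g : ℝ → Fin N → ℂ}
    (hf : f ∈ μ.preL2) (hg : g ∈ μ.preL2) :
    inner ℂ (μ.mulBdd hφ (μ.toL2v f hf)) (μ.toL2v g hg)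
      = ∫ x, star (φ x) * μ.form f g x ∂μ.traceMeasure := by
  rw [mulBdd_toL2v, inner_toL2v]
  congr 1
  funext x
  have := μ.form_fun_smul φ (fun _ => 1) f g x
  simpa using this

end MatrixMeasure

/-! ### The Cayley transform and density in `L²_v(μ)` -/

/-- The Cayley transform `x ↦ (x - i) / (x + i) = 1 - 2i (x + i)⁻¹`, onto the unit circle
without the point `1`. -/
def cayley (x : ℝ) : ℂ := 1 - 2 * Complex.I * ((x : ℂ) + Complex.I)⁻¹

theorem ofReal_add_ne_zero (x : ℝ) {c : ℂ} (hc : c.im ≠ 0) : (x : ℂ) + c ≠ 0 := fun h => by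
  have := congrArg Complex.im h
  simp [hc] at this

theorem cayley_eq (x : ℝ) : cayley x = ⟨(x ^ 2 - 1) / (x ^ 2 + 1), -2 * x / (x ^ 2 + 1)⟩ := by
  have h1 : (x : ℂ) + Complex.I ≠ 0 := ofReal_add_ne_zero x (by simp)
  have h2 : ((x : ℂ) ^ 2 + 1) ≠ 0 := by
    norm_cast
    positivity
  have h3 : (⟨(x ^ 2 - 1) / (x ^ 2 + 1), -2 * x / (x ^ 2 + 1)⟩ : ℂ)
      = ((x ^ 2 - 1) / (x ^ 2 + 1) : ℝ) + ((-2 * x / (x ^ 2 + 1) : ℝ) : ℂ) * Complex.I :=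
    Complex.mk_eq_add_mul_I _ _
  rw [h3, cayley]
  push_cast
  field_simp
  ring_nf
  simp only [Complex.I_sq]
  ring

theorem star_cayley (x : ℝ) :
    star (cayley x) = 1 + 2 * Complex.I * ((x : ℂ) + -Complex.I)⁻¹ := by
  simp [cayley]

theorem continuous_cayley : Continuous cayley := by
  unfold cayley
  have : ∀ x : ℝ, (x : ℂ) + Complex.I ≠ 0 := fun x => ofReal_add_ne_zero x (by simp)
  fun_prop (disch := assumption)

theorem cayley_mem_sphere (x : ℝ) : cayley x ∈ Metric.sphere (0 : ℂ) 1 := by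
  rw [mem_sphere_zero_iff_norm, ← sq_eq_sq₀ (norm_nonneg _) zero_le_one, ← Complex.normSq_eq_norm_sq,
    Complex.normSq_apply, cayley_eq]
  have : x ^ 2 + 1 ≠ 0 := by positivity
  field_simp
  ring

/-- The Cayley transform as a map into the unit circle. -/
def cayleyCircle (x : ℝ) : Metric.sphere (0 : ℂ) 1 := ⟨cayley x, cayley_mem_sphere x⟩

theorem continuous_cayleyCircle : Continuous cayleyCircle :=
  continuous_cayley.subtype_mk _

/-- A compactly supported continuous function on the line extends to the circle along the Cayley
transform. -/
theorem exists_comp_cayleyCircle_eq {ψ : ℝ → ℝ} (hψ : Continuous ψ) (hs : HasCompactSupport ψ) :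
    ∃ φ : C(Metric.sphere (0 : ℂ) 1, ℂ), ∀ x, φ (cayleyCircle x) = ψ x := by
  classical
  -- the inverse of the Cayley transform is `w ↦ -Im w / (1 - Re w)`
  let s : ℂ → ℝ := fun w => -w.im / (1 - w.re)
  have hre : ∀ w : Metric.sphere (0 : ℂ) 1, (w : ℂ) ≠ 1 → 0 < 1 - (w : ℂ).re := by
    intro w hw
    have h1 : (w : ℂ).re ≤ 1 := (Complex.re_le_norm _).trans (mem_sphere_zero_iff_norm.1 w.2).le
    refine sub_pos.2 (lt_of_le_of_ne h1 fun h => hw ?_)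
    have h2 : ‖(w : ℂ)‖ ^ 2 = 1 := by rw [mem_sphere_zero_iff_norm.1 w.2, one_pow]
    rw [← Complex.normSq_eq_norm_sq, Complex.normSq_apply, h] at h2
    exact Complex.ext h (by simpa using h2)
  obtain ⟨R, hR⟩ : ∃ R : ℝ, ∀ x, R < x ^ 2 → ψ x = 0 := by
    obtain ⟨R, hR⟩ := hs.isCompact.isBounded.exists_norm_le
    refine ⟨R ^ 2, fun x hx => ?_⟩
    by_contra h
    have h1 := hR x (subset_tsupport _ h)
    rw [Real.norm_eq_abs, ← sq_abs] at *
    exact absurd (pow_le_pow_left₀ (abs_nonneg x) h1 2) (by simpa using hx)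
  refine ⟨⟨fun w => if (w : ℂ) = 1 then 0 else ψ (s w), ?_⟩, fun x => ?_⟩
  · rw [continuous_iff_continuousAt]
    intro w
    by_cases hw : (w : ℂ) = 1
    · -- the function vanishes where `s(w)² = (1 + Re w) / (1 - Re w)` exceeds `R`
      refine continuousAt_const.congr (f := fun _ => (0 : ℂ)) ?_
      have ho : IsOpen {z : Metric.sphere (0 : ℂ) 1 | R * (1 - (z : ℂ).re) < 1 + (z : ℂ).re} :=
        isOpen_lt (by fun_prop) (by fun_prop)
      filter_upwards [ho.mem_nhds (show R * (1 - (w : ℂ).re) < 1 + (w : ℂ).re by simp [hw])]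
        with z hz
      split_ifs with h
      · rfl
      · have hz1 := hre z h
        have h2 : ‖(z : ℂ)‖ ^ 2 = 1 := by rw [mem_sphere_zero_iff_norm.1 z.2, one_pow]
        rw [← Complex.normSq_eq_norm_sq, Complex.normSq_apply] at h2
        have h3 : (s z) ^ 2 = (1 + (z : ℂ).re) / (1 - (z : ℂ).re) := by
          simp only [s]
          rw [div_pow, div_eq_div_iff (by positivity) hz1.ne']
          linear_combination (1 - (z : ℂ).re) * h2
        rw [hR, Complex.ofReal_zero]
        rw [h3, lt_div_iff₀ hz1]
        exact hz
    · have ho : IsOpen {z : Metric.sphere (0 : ℂ) 1 | (z : ℂ) ≠ 1} :=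
        isOpen_ne_fun (by fun_prop) (by fun_prop)
      have h1 : ContinuousAt (fun z : Metric.sphere (0 : ℂ) 1 => ((ψ (s z) : ℝ) : ℂ)) w := by
        refine Complex.continuous_ofReal.continuousAt.comp (hψ.continuousAt.comp ?_)
        exact ContinuousAt.div (by fun_prop) (by fun_prop) (hre w hw).ne'
      refine h1.congr ?_
      filter_upwards [ho.mem_nhds hw] with z hz
      rw [if_neg hz]
  · have h0 : (0 : ℝ) < x ^ 2 + 1 := by positivity
    have h1 : s (cayley x) = x := by
      simp only [s, cayley_eq]
      rw [div_eq_iff]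
      · field_simp
        ring
      · have : 1 - (x ^ 2 - 1) / (x ^ 2 + 1) = 2 / (x ^ 2 + 1) := by
          field_simp
          ring
        rw [this]
        positivity
    have h2 : cayley x ≠ 1 := by
      intro h
      have h3 := congrArg Complex.re h
      rw [cayley_eq, Complex.one_re, div_eq_one_iff_eq h0.ne'] at h3
      linarith
    change (if cayley x = 1 then (0 : ℂ) else ψ (s (cayley x))) = ψ x
    rw [if_neg h2, h1]

theorem isBddMeasurable_comp_cayleyCircle (φ : C(Metric.sphere (0 : ℂ) 1, ℂ)) :
    IsBddMeasurable fun x => φ (cayleyCircle x) :=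
  ⟨(φ.continuous.comp continuous_cayleyCircle).measurable, ‖φ‖, fun _ => φ.norm_coe_le_norm _⟩

namespace MatrixMeasure

variable {N : ℕ} (μ : MatrixMeasure N)

/-- A closed subspace of `L²_v(μ)` that is invariant under multiplication by `(x ± i)⁻¹` is
invariant under multiplication by continuous functions of the Cayley transform; this is the
Stone–Weierstrass theorem on the circle. -/
theorem mulBdd_cayley_mem {K : Submodule ℂ μ.L2v} (hK : IsClosed (K : Set μ.L2v))
    (hinv : ∀ (c : ℂ) (hc : c.im ≠ 0), ∀ u ∈ K, μ.mulBdd (IsBddMeasurable.resolvent hc) u ∈ K)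
    (φ : C(Metric.sphere (0 : ℂ) 1, ℂ)) :
    ∀ u ∈ K, μ.mulBdd (isBddMeasurable_comp_cayleyCircle φ) u ∈ K := by
  have hI : Complex.I.im ≠ 0 := by simp
  have hI' : (-Complex.I).im ≠ 0 := by simp
  induction φ using ContinuousMap.induction_on_of_compact with
  | const c =>
    intro u hu
    rw [μ.mulBdd_congr (isBddMeasurable_comp_cayleyCircle (.const _ c)) (IsBddMeasurable.const c)
      fun x => rfl, mulBdd_const]
    exact K.smul_mem c hu
  | id =>
    intro u hu
    rw [μ.mulBdd_one_add_mul (IsBddMeasurable.resolvent hI) (c := -(2 * Complex.I))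
      (isBddMeasurable_comp_cayleyCircle (.restrict _ (.id ℂ)))
      fun x => show cayley x = _ by rw [cayley]; ring]
    exact K.add_mem hu (K.smul_mem _ (hinv _ hI u hu))
  | star_id =>
    intro u hu
    rw [μ.mulBdd_one_add_mul (IsBddMeasurable.resolvent hI') (c := 2 * Complex.I)
      (isBddMeasurable_comp_cayleyCircle (star (.restrict _ (.id ℂ))))
      fun x => star_cayley x]
    exact K.add_mem hu (K.smul_mem _ (hinv _ hI' u hu))
  | add φ ψ hφ hψ =>
    intro u hu
    rw [μ.mulBdd_congr (isBddMeasurable_comp_cayleyCircle (φ + ψ))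
      ((isBddMeasurable_comp_cayleyCircle φ).add (isBddMeasurable_comp_cayleyCircle ψ))
      fun x => rfl,
      μ.mulBdd_add (isBddMeasurable_comp_cayleyCircle φ) (isBddMeasurable_comp_cayleyCircle ψ)]
    exact K.add_mem (hφ u hu) (hψ u hu)
  | mul φ ψ hφ hψ =>
    intro u hu
    rw [μ.mulBdd_congr (isBddMeasurable_comp_cayleyCircle (φ * ψ))
      ((isBddMeasurable_comp_cayleyCircle φ).mul (isBddMeasurable_comp_cayleyCircle ψ))
      fun x => rfl,
      μ.mulBdd_mul (isBddMeasurable_comp_cayleyCircle φ) (isBddMeasurable_comp_cayleyCircle ψ)]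
    exact hφ _ (hψ u hu)
  | frequently φ hφ =>
    intro u hu
    have hlip : LipschitzWith ‖u‖₊ fun ψ : C(Metric.sphere (0 : ℂ) 1, ℂ) =>
        μ.mulBdd (isBddMeasurable_comp_cayleyCircle ψ) u := by
      refine LipschitzWith.of_dist_le_mul fun ψ χ => ?_
      have h1 : μ.mulBdd (isBddMeasurable_comp_cayleyCircle ψ) u
          = μ.mulBdd (isBddMeasurable_comp_cayleyCircle (ψ - χ)) u
            + μ.mulBdd (isBddMeasurable_comp_cayleyCircle χ) u := by
        rw [← mulBdd_add]
        exact congrArg (· u) (μ.mulBdd_congr (isBddMeasurable_comp_cayleyCircle ψ)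
          ((isBddMeasurable_comp_cayleyCircle (ψ - χ)).add (isBddMeasurable_comp_cayleyCircle χ))
          fun x => by simp)
      rw [dist_eq_norm, dist_eq_norm, h1, add_sub_cancel_right, mul_comm, coe_nnnorm]
      exact μ.norm_mulBdd_le _ (fun x => (ψ - χ).norm_coe_le_norm _) u
    have hcl : IsClosed {ψ : C(Metric.sphere (0 : ℂ) 1, ℂ) |
        μ.mulBdd (isBddMeasurable_comp_cayleyCircle ψ) u ∈ K} := hK.preimage hlip.continuous
    exact hcl.mem_of_frequently_of_tendsto (hφ.mono fun ψ h => h u hu) Filter.tendsto_id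

theorem const_mem_preL2 (v : Fin N → ℂ) : (fun _ : ℝ => v) ∈ μ.preL2 := by
  refine ⟨measurable_const, ?_⟩
  have h : μ.form (fun _ => v) (fun _ => v)
      = fun x => ∑ i, ∑ j, star (v i) * μ.weight x i j * v j := funext fun x => quad_eq_sum _ _ _
  rw [h]
  exact integrable_finsetSum _ fun i _ => integrable_finsetSum _ fun j _ =>
    ((μ.integrable_weight i j).const_mul _).mul_const _

/-- A closed subspace of `L²_v(μ)` that contains the constants and is invariant under
multiplication by `(x + c)⁻¹` for non-real `c` is the whole space. -/
theorem eq_top_of_resolvent_invariant [CompleteSpace μ.L2v] {K : Submodule ℂ μ.L2v}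
    (hK : IsClosed (K : Set μ.L2v))
    (hconst : ∀ v : Fin N → ℂ, μ.toL2v _ (μ.const_mem_preL2 v) ∈ K)
    (hinv : ∀ (c : ℂ) (hc : c.im ≠ 0), ∀ u ∈ K, μ.mulBdd (IsBddMeasurable.resolvent hc) u ∈ K) :
    K = ⊤ := by
  have : CompleteSpace K := hK.completeSpace_coe
  rw [← Submodule.orthogonal_eq_bot_iff, Submodule.eq_bot_iff]
  intro u hu
  obtain ⟨g, hg, rfl⟩ := μ.exists_toL2v u
  rw [Submodule.mem_orthogonal] at hu
  -- testing against `ψ v` with `ψ` a bump function shows `v^* W g = 0` for all `v`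
  have h1 : ∀ v : Fin N → ℂ, ∀ᵐ x ∂μ.traceMeasure, μ.form (fun _ => v) g x = 0 := by
    intro v
    have hi : Integrable (μ.form (fun _ => v) g) μ.traceMeasure :=
      μ.integrable_form ⟨_, μ.const_mem_preL2 v⟩ ⟨g, hg⟩
    refine ae_eq_zero_of_integral_contDiff_smul_eq_zero hi.locallyIntegrable fun ψ hψ hs => ?_
    obtain ⟨φ, hφ⟩ := exists_comp_cayleyCircle_eq hψ.continuous hs
    have h2 := hu _ (μ.mulBdd_cayley_mem hK hinv φ _ (hconst v))
    rw [inner_mulBdd_left] at h2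
    rw [← h2]
    congr 1
    funext x
    simp [hφ]
  have h2 : ∀ᵐ x ∂μ.traceMeasure, ∀ i, μ.form (fun _ => Pi.single i 1) g x = 0 :=
    ae_all_iff.2 fun i => h1 _
  rw [← inner_self_eq_zero (𝕜 := ℂ), inner_toL2v]
  refine integral_eq_zero_of_ae ?_
  filter_upwards [h2] with x hx
  have h3 : μ.weight x *ᵥ g x = 0 := by
    funext i
    have := hx i
    rw [form, ← Pi.single_star, single_dotProduct] at this
    simpa using this
  simp [form, h3]

end MatrixMeasure

/-! ### Matrix polynomials -/

section EvalReal

variable {N : ℕ}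

theorem Polynomial.evalReal_add (P Q : Polynomial (Matrix (Fin N) (Fin N) ℂ)) (x : ℝ) :
    (P + Q).evalReal x = P.evalReal x + Q.evalReal x := Polynomial.eval_add

theorem Polynomial.evalReal_C (A : Matrix (Fin N) (Fin N) ℂ) (x : ℝ) :
    (Polynomial.C A).evalReal x = A := Polynomial.eval_C

theorem Polynomial.evalReal_C_mul (A : Matrix (Fin N) (Fin N) ℂ)
    (P : Polynomial (Matrix (Fin N) (Fin N) ℂ)) (x : ℝ) :
    (Polynomial.C A * P).evalReal x = A * P.evalReal x := Polynomial.eval_C_mul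

theorem Polynomial.evalReal_X_mul (P : Polynomial (Matrix (Fin N) (Fin N) ℂ)) (x : ℝ) :
    (Polynomial.X * P).evalReal x = (x : ℂ) • P.evalReal x := by
  rw [Polynomial.evalReal, Polynomial.X_mul, Polynomial.eval_mul_X, Polynomial.evalReal]
  rw [Matrix.scalar_apply, ← Matrix.smul_one_eq_diagonal, Matrix.mul_smul, Matrix.mul_one]

theorem Polynomial.evalReal_monomial (k : ℕ) (A : Matrix (Fin N) (Fin N) ℂ) (x : ℝ) :
    (Polynomial.monomial k A).evalReal x = (x : ℂ) ^ k • A := by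
  rw [Polynomial.evalReal, Polynomial.eval_monomial, ← map_pow, Matrix.scalar_apply,
    ← Matrix.smul_one_eq_diagonal, Matrix.mul_smul, Matrix.mul_one]

theorem Polynomial.continuous_evalReal (P : Polynomial (Matrix (Fin N) (Fin N) ℂ)) :
    Continuous P.evalReal := by
  induction P using Polynomial.induction_on' with
  | add P Q hP hQ =>
    have : Polynomial.evalReal (P + Q) = fun x => P.evalReal x + Q.evalReal x :=
      by funext x; exact Polynomial.evalReal_add P Q x
    rw [this]
    exact hP.add hQ
  | monomial k A =>
    have : Polynomial.evalReal (Polynomial.monomial k A) = fun x : ℝ => (x : ℂ) ^ k • A :=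
      by funext x; exact Polynomial.evalReal_monomial k A x
    rw [this]
    fun_prop

end EvalReal

namespace MatrixMeasure

variable {N : ℕ} (μ : MatrixMeasure N)

theorem integrable_poly_entry (hμ : μ.IsAdmissible)
    (P Q : Polynomial (Matrix (Fin N) (Fin N) ℂ)) (i j : Fin N) :
    Integrable (fun x => (P.evalReal x * μ.weight x * (Q.evalReal x)ᴴ) i j) μ.traceMeasure := by
  induction P using Polynomial.induction_on' with
  | add P P' hP hP' =>
    simp only [Polynomial.evalReal_add, add_mul, Matrix.add_apply]
    exact hP.add hP'
  | monomial k A =>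
    induction Q using Polynomial.induction_on' with
    | add Q Q' hQ hQ' =>
      simp only [Polynomial.evalReal_add, conjTranspose_add, mul_add, Matrix.add_apply]
      exact hQ.add hQ'
    | monomial l B =>
      have h : (fun x : ℝ => ((Polynomial.monomial k A).evalReal x * μ.weight x *
          ((Polynomial.monomial l B).evalReal x)ᴴ) i j) = fun x : ℝ =>
          ∑ b, ∑ a, (A i a * star (B j b)) * ((x : ℂ) ^ (k + l) * μ.weight x a b) := by
        funext x
        rw [Polynomial.evalReal_monomial, Polynomial.evalReal_monomial]
        simp only [Matrix.mul_apply, Finset.sum_mul, Matrix.smul_apply, conjTranspose_apply,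
          smul_eq_mul, star_mul', star_pow, Complex.star_def, Complex.conj_ofReal, pow_add]
        refine Finset.sum_congr rfl fun b _ => Finset.sum_congr rfl fun a _ => ?_
        ring
      rw [h]
      exact integrable_finsetSum _ fun b _ => integrable_finsetSum _ fun a _ =>
        (hμ.integrable_moment a b (k + l)).const_mul _

/-- The scalar form on the functions `P^* v` is the quadratic form of `P W Q^*`. -/
theorem form_poly (P Q : Polynomial (Matrix (Fin N) (Fin N) ℂ)) (v w : Fin N → ℂ) (x : ℝ) :
    μ.form (fun x => (P.evalReal x)ᴴ *ᵥ v) (fun x => (Q.evalReal x)ᴴ *ᵥ w) x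
      = star v ⬝ᵥ ((P.evalReal x * μ.weight x * (Q.evalReal x)ᴴ) *ᵥ w) := by
  rw [form, star_mulVec, conjTranspose_conjTranspose, ← dotProduct_mulVec, mulVec_mulVec,
    mulVec_mulVec]

theorem integrable_form_poly (hμ : μ.IsAdmissible)
    (P Q : Polynomial (Matrix (Fin N) (Fin N) ℂ)) (v w : Fin N → ℂ) :
    Integrable (μ.form (fun x => (P.evalReal x)ᴴ *ᵥ v) (fun x => (Q.evalReal x)ᴴ *ᵥ w))
      μ.traceMeasure := by
  have h : μ.form (fun x => (P.evalReal x)ᴴ *ᵥ v) (fun x => (Q.evalReal x)ᴴ *ᵥ w)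
      = fun x => ∑ i, ∑ j,
        star (v i) * (P.evalReal x * μ.weight x * (Q.evalReal x)ᴴ) i j * w j := by
    funext x
    rw [form_poly, quad_eq_sum]
  rw [h]
  exact integrable_finsetSum _ fun i _ => integrable_finsetSum _ fun j _ =>
    ((μ.integrable_poly_entry hμ P Q i j).const_mul _).mul_const _

theorem poly_mem_preL2 (hμ : μ.IsAdmissible) (P : Polynomial (Matrix (Fin N) (Fin N) ℂ))
    (v : Fin N → ℂ) : (fun x : ℝ => (P.evalReal x)ᴴ *ᵥ v) ∈ μ.preL2 :=
  ⟨(P.continuous_evalReal.matrix_conjTranspose.matrix_mulVec continuous_const).measurable,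
    μ.integrable_form_poly hμ P P v v⟩

theorem setIntegral_form_poly (hμ : μ.IsAdmissible) (B : Set ℝ)
    (P Q : Polynomial (Matrix (Fin N) (Fin N) ℂ)) (v w : Fin N → ℂ) :
    ∫ x in B, μ.form (fun x => (P.evalReal x)ᴴ *ᵥ v) (fun x => (Q.evalReal x)ᴴ *ᵥ w) x
        ∂μ.traceMeasure
      = star v ⬝ᵥ (μ.matIntegral B (fun _ => 1) P Q *ᵥ w) := by
  simp only [form_poly, quad_eq_sum, matIntegral, one_mul, Matrix.of_apply]
  have hi := fun i j => (μ.integrable_poly_entry hμ P Q i j).integrableOn (s := B)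
  rw [integral_finsetSum _ fun i _ => integrable_finsetSum _ fun j _ =>
    ((hi i j).const_mul _).mul_const _]
  refine Finset.sum_congr rfl fun i _ => ?_
  rw [integral_finsetSum _ fun j _ => ((hi i j).const_mul _).mul_const _]
  refine Finset.sum_congr rfl fun j _ => ?_
  rw [integral_mul_const, integral_const_mul]

/-- The matrix inner product `∫ P W Q^* dτ_μ` of two matrix polynomials. -/
def gram (P Q : Polynomial (Matrix (Fin N) (Fin N) ℂ)) : Matrix (Fin N) (Fin N) ℂ :=
  μ.matIntegral Set.univ (fun _ => 1) P Q

theorem gram_apply (P Q : Polynomial (Matrix (Fin N) (Fin N) ℂ)) (i j : Fin N) :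
    μ.gram P Q i j
      = ∫ x, (P.evalReal x * μ.weight x * (Q.evalReal x)ᴴ) i j ∂μ.traceMeasure := by
  simp [gram, matIntegral]

theorem gram_add_left (hμ : μ.IsAdmissible) (P P' Q : Polynomial (Matrix (Fin N) (Fin N) ℂ)) :
    μ.gram (P + P') Q = μ.gram P Q + μ.gram P' Q := by
  ext i j
  simp only [gram_apply, Matrix.add_apply, Polynomial.evalReal_add, add_mul]
  exact integral_add (μ.integrable_poly_entry hμ P Q i j) (μ.integrable_poly_entry hμ P' Q i j)

theorem gram_C_mul_left (hμ : μ.IsAdmissible) (A : Matrix (Fin N) (Fin N) ℂ)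
    (P Q : Polynomial (Matrix (Fin N) (Fin N) ℂ)) :
    μ.gram (Polynomial.C A * P) Q = A * μ.gram P Q := by
  ext i j
  rw [Matrix.mul_apply]
  simp only [gram_apply, Polynomial.evalReal_C_mul, Matrix.mul_assoc]
  simp only [← Matrix.mul_assoc (Polynomial.evalReal P _)]
  simp only [Matrix.mul_apply (M := A)]
  rw [integral_finsetSum _ fun k _ => (μ.integrable_poly_entry hμ P Q k j).const_mul _]
  exact Finset.sum_congr rfl fun k _ => integral_const_mul _ _

theorem gram_sum_left (hμ : μ.IsAdmissible) {ι : Type*} (s : Finset ι)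
    (P : ι → Polynomial (Matrix (Fin N) (Fin N) ℂ)) (Q : Polynomial (Matrix (Fin N) (Fin N) ℂ)) :
    μ.gram (∑ k ∈ s, P k) Q = ∑ k ∈ s, μ.gram (P k) Q := by
  classical
  induction s using Finset.induction_on with
  | empty => simpa using μ.gram_C_mul_left hμ 0 0 Q
  | insert k s hk ih => rw [Finset.sum_insert hk, Finset.sum_insert hk, gram_add_left _ hμ, ih]

theorem conjTranspose_gram (P Q : Polynomial (Matrix (Fin N) (Fin N) ℂ)) :
    (μ.gram P Q)ᴴ = μ.gram Q P := by
  ext i j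
  rw [conjTranspose_apply, gram_apply, gram_apply, Complex.star_def, ← integral_conj]
  refine integral_congr_ae ?_
  filter_upwards [μ.weight_posSemidef] with x hx
  rw [← Complex.star_def, ← conjTranspose_apply, conjTranspose_mul, conjTranspose_mul,
    conjTranspose_conjTranspose, hx.isHermitian.eq, Matrix.mul_assoc]

theorem gram_X_mul_left (P Q : Polynomial (Matrix (Fin N) (Fin N) ℂ)) :
    μ.gram (Polynomial.X * P) Q = μ.matIntegral Set.univ (fun x => (x : ℂ)) P Q := by
  ext i j
  simp [gram_apply, matIntegral, Polynomial.evalReal_X_mul]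

theorem gram_X_mul_right (P Q : Polynomial (Matrix (Fin N) (Fin N) ℂ)) :
    μ.gram P (Polynomial.X * Q) = μ.gram (Polynomial.X * P) Q := by
  ext i j
  simp [gram_apply, Polynomial.evalReal_X_mul, conjTranspose_smul]

/-! ### The three-term recurrence -/

variable {μ} {P : ℕ → Polynomial (Matrix (Fin N) (Fin N) ℂ)}

theorem IsOrthonormalSeq.gram_eq (hP : μ.IsOrthonormalSeq P) (n m : ℕ) :
    μ.gram (P n) (P m) = if n = m then 1 else 0 := hP.orthonormal n m

theorem IsOrthonormalSeq.isUnit_coeff (hP : μ.IsOrthonormalSeq P) (n : ℕ) :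
    IsUnit ((P n).coeff n) := by
  have := hP.isUnit_leadingCoeff n
  rwa [Polynomial.leadingCoeff, hP.natDegree] at this

theorem IsOrthonormalSeq.coeff_eq_zero (hP : μ.IsOrthonormalSeq P) {n m : ℕ} (h : n < m) :
    (P n).coeff m = 0 :=
  Polynomial.coeff_eq_zero_of_natDegree_lt (by rwa [hP.natDegree])

/-- The orthonormal polynomials span, as their leading coefficients are invertible. -/
theorem IsOrthonormalSeq.exists_eq_sum (hP : μ.IsOrthonormalSeq P) (n : ℕ)
    (Q : Polynomial (Matrix (Fin N) (Fin N) ℂ)) (hQ : Q.degree < n) :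
    ∃ c : ℕ → Matrix (Fin N) (Fin N) ℂ, Q = ∑ k ∈ Finset.range n, Polynomial.C (c k) * P k := by
  induction n generalizing Q with
  | zero => exact ⟨0, by simpa using hQ⟩
  | succ n ih =>
    obtain ⟨u, hu⟩ := hP.isUnit_coeff n
    set a : Matrix (Fin N) (Fin N) ℂ := Q.coeff n * ((u⁻¹ : (Matrix (Fin N) (Fin N) ℂ)ˣ) : Matrix (Fin N) (Fin N) ℂ) with ha
    have hR : (Q - Polynomial.C a * P n).degree < n := by
      rw [Polynomial.degree_lt_iff_coeff_zero]
      intro m hm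
      rw [Polynomial.coeff_sub, Polynomial.coeff_C_mul]
      rcases hm.eq_or_lt with rfl | hm'
      · rw [ha, ← hu, Matrix.mul_assoc, Units.inv_mul, mul_one, sub_self]
      · rw [hP.coeff_eq_zero hm', mul_zero, sub_zero]
        exact (Polynomial.degree_lt_iff_coeff_zero _ _).1 hQ m hm'
    obtain ⟨c, hc⟩ := ih _ hR
    refine ⟨Function.update c n a, ?_⟩
    rw [Finset.sum_range_succ, Function.update_self, ← sub_eq_iff_eq_add, hc]
    refine Finset.sum_congr rfl fun k hk => ?_
    rw [Function.update_of_ne (Finset.mem_range.1 hk).ne]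

/-- Expansion of a matrix polynomial in the orthonormal polynomials. -/
theorem IsOrthonormalSeq.eq_sum_gram (hμ : μ.IsAdmissible) (hP : μ.IsOrthonormalSeq P) {n : ℕ}
    {Q : Polynomial (Matrix (Fin N) (Fin N) ℂ)} (hQ : Q.degree < n) :
    Q = ∑ k ∈ Finset.range n, Polynomial.C (μ.gram Q (P k)) * P k := by
  obtain ⟨c, hc⟩ := hP.exists_eq_sum n Q hQ
  have h : ∀ k ∈ Finset.range n, μ.gram Q (P k) = c k := by
    intro k hk
    conv_lhs => rw [hc]
    simp [gram_sum_left _ hμ, gram_C_mul_left _ hμ, hP.gram_eq, Finset.mem_range.1 hk]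
  conv_lhs => rw [hc]
  exact Finset.sum_congr rfl fun k hk => by rw [h k hk]

theorem IsOrthonormalSeq.gram_eq_zero (hμ : μ.IsAdmissible) (hP : μ.IsOrthonormalSeq P) {n m : ℕ}
    {Q : Polynomial (Matrix (Fin N) (Fin N) ℂ)} (hQ : Q.degree < n) (hm : n ≤ m) :
    μ.gram Q (P m) = 0 := by
  rw [hP.eq_sum_gram hμ hQ, gram_sum_left _ hμ]
  refine Finset.sum_eq_zero fun k hk => ?_
  rw [gram_C_mul_left _ hμ, hP.gram_eq, if_neg, mul_zero]
  exact ((Finset.mem_range.1 hk).trans_le hm).ne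

theorem IsOrthonormalSeq.degree_X_mul_lt (hP : μ.IsOrthonormalSeq P) (n : ℕ) :
    (Polynomial.X * P n).degree < ((n + 2 : ℕ) : WithBot ℕ) := by
  rw [Polynomial.degree_lt_iff_coeff_zero]
  intro m hm
  obtain ⟨m, rfl⟩ : ∃ k, m = k + 1 := ⟨m - 1, by omega⟩
  rw [Polynomial.coeff_X_mul]
  exact hP.coeff_eq_zero (by omega)

theorem gram_X_mul_succ (n : ℕ) :
    μ.gram (Polynomial.X * P n) (P (n + 1)) = μ.coeffA P n := gram_X_mul_left _ _ _

theorem gram_X_mul_self (n : ℕ) : μ.gram (Polynomial.X * P n) (P n) = μ.coeffB P n :=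
  gram_X_mul_left _ _ _

theorem gram_X_mul_pred (n : ℕ) :
    μ.gram (Polynomial.X * P (n + 1)) (P n) = (μ.coeffA P n)ᴴ := by
  rw [← gram_X_mul_succ, conjTranspose_gram, gram_X_mul_right]

theorem isHermitian_coeffB (n : ℕ) : (μ.coeffB P n).IsHermitian := by
  rw [Matrix.IsHermitian, ← gram_X_mul_self, conjTranspose_gram, gram_X_mul_right]

theorem IsOrthonormalSeq.recurrence_zero (hμ : μ.IsAdmissible) (hP : μ.IsOrthonormalSeq P) :
    Polynomial.X * P 0 = Polynomial.C (μ.coeffA P 0) * P 1 + Polynomial.C (μ.coeffB P 0) * P 0 := by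
  have h := hP.eq_sum_gram hμ (hP.degree_X_mul_lt 0)
  rw [Finset.sum_range_succ, Finset.sum_range_succ, Finset.sum_range_zero, zero_add,
    gram_X_mul_succ, gram_X_mul_self, add_comm] at h
  exact h

theorem IsOrthonormalSeq.recurrence_succ (hμ : μ.IsAdmissible) (hP : μ.IsOrthonormalSeq P)
    (n : ℕ) : Polynomial.X * P (n + 1) = Polynomial.C (μ.coeffA P (n + 1)) * P (n + 2)
      + Polynomial.C (μ.coeffB P (n + 1)) * P (n + 1) + Polynomial.C (μ.coeffA P n)ᴴ * P n := by
  have h := hP.eq_sum_gram hμ (hP.degree_X_mul_lt (n + 1))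
  -- `∫ x P_{n+1} W P_k^* = ∫ P_{n+1} W (x P_k)^*` vanishes for `k < n`
  have h0 : ∑ k ∈ Finset.range n,
      Polynomial.C (μ.gram (Polynomial.X * P (n + 1)) (P k)) * P k = 0 := by
    refine Finset.sum_eq_zero fun k hk => ?_
    rw [← gram_X_mul_right, ← conjTranspose_gram,
      hP.gram_eq_zero hμ (hP.degree_X_mul_lt k) (by have := Finset.mem_range.1 hk; omega)]
    simp
  rw [Finset.sum_range_succ, Finset.sum_range_succ, Finset.sum_range_succ, h0, zero_add,
    gram_X_mul_pred, gram_X_mul_self, gram_X_mul_succ] at h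
  rw [h]
  abel

/-- Comparing leading coefficients in the recurrence, `L_n = A_n L_{n+1}`. -/
theorem IsOrthonormalSeq.isUnit_coeffA (hμ : μ.IsAdmissible) (hP : μ.IsOrthonormalSeq P) (n : ℕ) :
    IsUnit (μ.coeffA P n) := by
  have h := congrArg (fun Q => Q.coeff (n + 1)) (hP.eq_sum_gram hμ (hP.degree_X_mul_lt n))
  simp only [Polynomial.coeff_X_mul, Polynomial.finsetSum_coeff, Polynomial.coeff_C_mul] at h
  rw [Finset.sum_range_succ, gram_X_mul_succ, Finset.sum_eq_zero, zero_add] at h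
  · have h1 := hP.isUnit_coeff n
    rw [h] at h1
    exact (hP.isUnit_coeff (n + 1)).mul_right_iff.1 h1
  · intro k hk
    rw [hP.coeff_eq_zero (Finset.mem_range.1 hk), mul_zero]

end MatrixMeasure

/-! ### Multiplication by the variable -/

namespace MatrixMeasure

variable {N : ℕ} (μ : MatrixMeasure N)

theorem mem_mulVarGraph_iff {u w : μ.L2v} : (u, w) ∈ μ.mulVarGraph ↔
    ∃ (f : ℝ → Fin N → ℂ) (hf : f ∈ μ.preL2) (hg : (fun x : ℝ => (x : ℂ) • f x) ∈ μ.preL2),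
      u = μ.toL2v f hf ∧ w = μ.toL2v (fun x : ℝ => (x : ℂ) • f x) hg :=
  exists_congr fun _ => exists_congr fun _ => exists_congr fun _ => Prod.mk_inj

theorem mem_mulVar_domain_iff {u : μ.L2v} :
    u ∈ μ.mulVar.domain ↔ ∃ w, (u, w) ∈ μ.mulVarGraph := by
  rw [← mulVar_graph, LinearPMap.mem_domain_iff]

theorem mulVar_apply_eq {u w : μ.L2v} (h : (u, w) ∈ μ.mulVarGraph) (hu : u ∈ μ.mulVar.domain) :
    μ.mulVar ⟨u, hu⟩ = w := by
  rw [← mulVar_graph, LinearPMap.mem_graph_iff] at h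
  obtain ⟨y, hy, rfl⟩ := h
  simp only at hy
  congr 1
  exact Subtype.ext hy.symm

/-- Multiplication by the variable is symmetric. -/
theorem inner_eq_of_mem_mulVarGraph {u u' w w' : μ.L2v} (hu : (u, u') ∈ μ.mulVarGraph)
    (hw : (w, w') ∈ μ.mulVarGraph) : inner ℂ u' w = inner ℂ u w' := by
  obtain ⟨f, hf, hf', rfl, rfl⟩ := μ.mem_mulVarGraph_iff.1 hu
  obtain ⟨g, hg, hg', rfl, rfl⟩ := μ.mem_mulVarGraph_iff.1 hw
  rw [inner_toL2v, inner_toL2v]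
  congr 1
  funext x
  have h1 := μ.form_fun_smul (fun x => (x : ℂ)) (fun _ => 1) f g x
  have h2 := μ.form_fun_smul (fun _ => 1) (fun x => (x : ℂ)) f g x
  simp only [one_smul, star_one, one_mul, mul_one, Complex.star_def, Complex.conj_ofReal] at h1 h2
  rw [h1, h2]

/-- Multiplication by `(x + c)⁻¹` is a right inverse of multiplication by `x + c`. -/
theorem resolvent_mem_mulVarGraph {c : ℂ} (hc : c.im ≠ 0) (u : μ.L2v) :
    (μ.mulBdd (IsBddMeasurable.resolvent hc) u, u - c • μ.mulBdd (IsBddMeasurable.resolvent hc) u)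
      ∈ μ.mulVarGraph := by
  obtain ⟨f, hf, rfl⟩ := μ.exists_toL2v u
  have h : (fun x : ℝ => (x : ℂ) • ((x : ℂ) + c)⁻¹ • f x)
      = f - c • fun x : ℝ => ((x : ℂ) + c)⁻¹ • f x := by
    funext x
    have hx := ofReal_add_ne_zero x hc
    simp only [Pi.sub_apply, Pi.smul_apply, smul_smul]
    rw [eq_sub_iff_add_eq, ← add_smul, ← add_mul, mul_inv_cancel₀ hx, one_smul]
  have hm := μ.bdd_smul_mem_preL2 (IsBddMeasurable.resolvent hc) hf
  refine μ.mem_mulVarGraph_iff.2 ⟨_, hm, ?_, rfl, ?_⟩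
  · rw [h]
    exact μ.preL2.sub_mem hf (μ.preL2.smul_mem c hm)
  · simp only [h]
    rfl

/-- Multiplication by `(x + c)⁻¹` is a left inverse of multiplication by `x + c`. -/
theorem mulBdd_resolvent_eq {c : ℂ} (hc : c.im ≠ 0) {u w : μ.L2v} (h : (u, w) ∈ μ.mulVarGraph) :
    μ.mulBdd (IsBddMeasurable.resolvent hc) (w + c • u) = u := by
  obtain ⟨f, hf, hf', rfl, rfl⟩ := μ.mem_mulVarGraph_iff.1 h
  rw [smul_toL2v, toL2v_add, mulBdd_toL2v]
  congr 1
  funext x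
  have hx := ofReal_add_ne_zero x hc
  simp only [Pi.add_apply, Pi.smul_apply]
  rw [← add_smul, smul_smul, inv_mul_cancel₀ hx, one_smul]

/-! ### The spectral measure of multiplication by the variable -/

section Spectral

variable {H : Type*} [NormedAddCommGroup H] [InnerProductSpace ℂ H]
  (U : H ≃ₗᵢ[ℂ] μ.L2v)

open scoped Classical in
/-- The projections `U⁻¹ χ_B U`, where `χ_B` is multiplication by the indicator of `B`. -/
def spectralProj (B : Set ℝ) : H →L[ℂ] H :=
  if hB : MeasurableSet B then
    (U.symm.toContinuousLinearEquiv : μ.L2v →L[ℂ] H) ∘L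
      μ.mulBdd (IsBddMeasurable.indicator hB) ∘L (U.toContinuousLinearEquiv : H →L[ℂ] μ.L2v)
  else 0

theorem spectralProj_apply {B : Set ℝ} (hB : MeasurableSet B) (u : H) :
    μ.spectralProj U B u = U.symm (μ.mulBdd (IsBddMeasurable.indicator hB) (U u)) := by
  rw [spectralProj, dif_pos hB]
  rfl

theorem inner_spectralProj {B : Set ℝ} (hB : MeasurableSet B) {u v : H} {f g : ℝ → Fin N → ℂ}
    (hf : f ∈ μ.preL2) (hg : g ∈ μ.preL2) (hu : U u = μ.toL2v f hf) (hv : U v = μ.toL2v g hg) :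
    inner ℂ v (μ.spectralProj U B u) = ∫ x in B, μ.form g f x ∂μ.traceMeasure := by
  rw [spectralProj_apply μ U hB, ← U.inner_map_map, U.apply_symm_apply, hu, hv,
    inner_mulBdd_right, ← integral_indicator hB]
  congr 1
  funext x
  by_cases hx : x ∈ B <;> simp [hx]

/-- The resolution of the identity `B ↦ U⁻¹ χ_B U`. -/
def spectralResolution [CompleteSpace H] : ResolutionOfIdentity H where
  proj := μ.spectralProj U
  not_measurable B hB := dif_neg hB
  isSelfAdjoint B hB := by
    rw [ContinuousLinearMap.isSelfAdjoint_iff_isSymmetric]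
    intro u v
    obtain ⟨f, hf, hu⟩ := μ.exists_toL2v (U u)
    obtain ⟨g, hg, hv⟩ := μ.exists_toL2v (U v)
    change inner ℂ (μ.spectralProj U B u) v = inner ℂ u (μ.spectralProj U B v)
    rw [μ.inner_spectralProj U hB hg hf hv hu, ← inner_conj_symm,
      μ.inner_spectralProj U hB hf hg hu hv, ← integral_conj]
    exact integral_congr_ae (ae_restrict_of_ae (μ.form_conj_symm f g))
  proj_inter B C hB hC := by
    ext u
    rw [mul_apply_eq_comp, spectralProj_apply μ U hB, spectralProj_apply μ U hC,
      spectralProj_apply μ U (hB.inter hC), U.apply_symm_apply, ← mulBdd_mul]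
    congr 2
    refine μ.mulBdd_congr _ _ fun x => ?_
    by_cases h1 : x ∈ B <;> by_cases h2 : x ∈ C <;> simp [h1, h2]
  proj_empty := by
    ext u
    rw [spectralProj_apply μ U MeasurableSet.empty,
      μ.mulBdd_congr (IsBddMeasurable.indicator MeasurableSet.empty) (IsBddMeasurable.const 0)
      (by simp), mulBdd_const]
    simp
  proj_univ := by
    ext u
    rw [spectralProj_apply μ U MeasurableSet.univ,
      μ.mulBdd_congr (IsBddMeasurable.indicator MeasurableSet.univ) (IsBddMeasurable.const 1)
      (by simp), mulBdd_const]
    simp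
  hasSum u v B hB hd := by
    obtain ⟨f, hf, hu⟩ := μ.exists_toL2v (U u)
    obtain ⟨g, hg, hv⟩ := μ.exists_toL2v (U v)
    rw [μ.inner_spectralProj U (MeasurableSet.iUnion hB) hf hg hu hv]
    simp only [fun i => μ.inner_spectralProj U (hB i) hf hg hu hv]
    exact hasSum_integral_iUnion hB hd (μ.integrable_form ⟨g, hg⟩ ⟨f, hf⟩).integrableOn

variable [CompleteSpace H]

/-- The complex measure `E_{u,v}` has density `(U v)^* W (U u)`. -/
theorem spectralResolution_toComplexMeasure {u v : H} {f g : ℝ → Fin N → ℂ}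
    (hf : f ∈ μ.preL2) (hg : g ∈ μ.preL2) (hu : U u = μ.toL2v f hf) (hv : U v = μ.toL2v g hg) :
    (μ.spectralResolution U).toComplexMeasure u v = μ.traceMeasure.withDensityᵥ (μ.form g f) := by
  ext B hB : 1
  rw [withDensityᵥ_apply (μ.integrable_form ⟨g, hg⟩ ⟨f, hf⟩) hB]
  exact μ.inner_spectralProj U hB hf hg hu hv

/-- An operator that `U` carries to multiplication by the variable has spectral resolution
`B ↦ U⁻¹ χ_B U`. -/
theorem isSpectralMeasureOf_spectralResolution {T : H →ₗ.[ℂ] H}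
    (hT : ∀ u w, (u, w) ∈ T.graph ↔ (U u, U w) ∈ μ.mulVarGraph) :
    (μ.spectralResolution U).IsSpectralMeasureOf T := by
  have hform : ∀ (f g : ℝ → Fin N → ℂ) (x : ℝ),
      μ.form g (fun x : ℝ => (x : ℂ) • f x) x = x • μ.form g f x := by
    intro f g x
    have := μ.form_fun_smul (fun _ => 1) (fun x => (x : ℂ)) g f x
    simpa using this
  have hform2 : ∀ (f : ℝ → Fin N → ℂ) (x : ℝ),
      μ.form (fun x : ℝ => (x : ℂ) • f x) (fun x : ℝ => (x : ℂ) • f x) x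
        = (x ^ 2) • μ.form f f x := by
    intro f x
    have := μ.form_fun_smul (fun x => (x : ℂ)) (fun x => (x : ℂ)) f f x
    rw [this]
    simp [sq]
  refine ⟨fun u => ⟨fun h => ?_, fun h => ?_⟩, fun u v => ?_⟩
  -- membership in the domain provides a representative `f` of `U u` with `x f(x)` in `𝓛²_v(μ)`
  · have h1 := (hT _ _).1 (T.mem_graph ⟨u, h⟩)
    obtain ⟨f, hf, hf', hu, -⟩ := μ.mem_mulVarGraph_iff.1 h1
    rw [μ.spectralResolution_toComplexMeasure U hf hf hu hu,
      integrable_withDensityᵥ_iff hf.2 (by fun_prop)]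
    exact hf'.2.congr (Filter.Eventually.of_forall (hform2 f))
  · obtain ⟨f, hf, hu⟩ := μ.exists_toL2v (U u)
    rw [μ.spectralResolution_toComplexMeasure U hf hf hu hu,
      integrable_withDensityᵥ_iff hf.2 (by fun_prop)] at h
    have hf' : (fun x : ℝ => (x : ℂ) • f x) ∈ μ.preL2 :=
      ⟨Complex.measurable_ofReal.smul hf.1,
        h.congr (Filter.Eventually.of_forall fun x => (hform2 f x).symm)⟩
    refine LinearPMap.mem_domain_iff.2 ⟨U.symm (μ.toL2v _ hf'), (hT _ _).2 ?_⟩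
    rw [U.apply_symm_apply]
    exact μ.mem_mulVarGraph_iff.2 ⟨f, hf, hf', hu, rfl⟩
  · have h1 := (hT _ _).1 (T.mem_graph u)
    obtain ⟨f, hf, hf', hu, hu'⟩ := μ.mem_mulVarGraph_iff.1 h1
    obtain ⟨g, hg, hv⟩ := μ.exists_toL2v (U v)
    have hi : Integrable (μ.form g f) μ.traceMeasure := μ.integrable_form ⟨g, hg⟩ ⟨f, hf⟩
    have hint : (μ.traceMeasure.withDensityᵥ (μ.form g f)).Integrable fun t : ℝ => t := by
      rw [integrable_withDensityᵥ_iff hi (by fun_prop)]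
      exact (μ.integrable_form ⟨g, hg⟩ ⟨_, hf'⟩).congr (Filter.Eventually.of_forall (hform f g))
    rw [μ.spectralResolution_toComplexMeasure U hf hg hu hv]
    refine ⟨hint, ?_⟩
    rw [integral_withDensityᵥ hi (by fun_prop) hint, ← U.inner_map_map, hv, hu', inner_toL2v]
    congr 1
    funext x
    exact hform f g x

end Spectral

end MatrixMeasure

/-! ### The block Jacobi operator on finitely supported vectors -/

section BlockJacobi

variable {N : ℕ} (A B : ℕ → Matrix (Fin N) (Fin N) ℂ)

theorem single_mem_finiteVectors (k : ℕ) (v : EuclideanSpace ℂ (Fin N)) :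
    (lp.single 2 k v : BlockEll2 N) ∈ finiteVectors N :=
  ⟨k + 1, fun n hn =>
    lp.single_apply_ne (E := fun _ : ℕ => EuclideanSpace ℂ (Fin N)) 2 k v (by omega)⟩

theorem dense_finiteVectors (N : ℕ) : Dense (finiteVectors N : Set (BlockEll2 N)) := by
  intro V
  refine mem_closure_of_tendsto (lp.hasSum_single (by simp) V) (Filter.Eventually.of_forall ?_)
  intro s
  exact (finiteVectors N).sum_mem fun k _ => single_mem_finiteVectors k _

theorem single_mem_blockJacobi_domain (k : ℕ) (v : EuclideanSpace ℂ (Fin N)) :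
    (lp.single 2 k v : BlockEll2 N) ∈ (blockJacobi A B).domain :=
  single_mem_finiteVectors k v

variable {A B} in
/-- A property of finitely supported vectors that is additive and holds on the summands
`e_k ⊗ v` holds throughout. -/
theorem blockJacobi_domain_induction {p : (blockJacobi A B).domain → Prop} (h0 : p 0)
    (hadd : ∀ V W, p V → p W → p (V + W))
    (hsingle : ∀ k v, p ⟨lp.single 2 k v, single_mem_blockJacobi_domain A B k v⟩)
    (V : (blockJacobi A B).domain) : p V := by
  have key : ∀ M (V : (blockJacobi A B).domain),
      (∀ n, M ≤ n → (V : BlockEll2 N) n = 0) → p V := by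
    intro M
    induction M with
    | zero =>
      intro V hV
      have : V = 0 := Subtype.ext (lp.ext (funext fun n => hV n (Nat.zero_le n)))
      rwa [this]
    | succ M ih =>
      intro V hV
      let s : (blockJacobi A B).domain :=
        ⟨lp.single 2 M ((V : BlockEll2 N) M), single_mem_blockJacobi_domain A B _ _⟩
      have h1 : p (V - s) := by
        refine ih _ fun n hn => ?_
        change (V : BlockEll2 N) n
          - (lp.single 2 M ((V : BlockEll2 N) M) : BlockEll2 N) n = 0
        rcases hn.eq_or_lt with rfl | hn
        · rw [lp.single_apply_self, sub_self]
        · rw [lp.single_apply_ne _ _ _ hn.ne', hV n hn, sub_zero]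
      have h2 := hadd _ _ h1 (hsingle M ((V : BlockEll2 N) M))
      rwa [show V - s + ⟨lp.single 2 M ((V : BlockEll2 N) M), _⟩ = V from sub_add_cancel V s] at h2
  obtain ⟨M, hM⟩ := V.2
  exact key M V hM

theorem blockJacobi_apply (V : (blockJacobi A B).domain) (n : ℕ) :
    (blockJacobi A B V : BlockEll2 N) n = blockJacobiSeq A B (V : BlockEll2 N) n := rfl

theorem blockJacobi_single_zero (v : EuclideanSpace ℂ (Fin N)) :
    blockJacobi A B ⟨lp.single 2 0 v, single_mem_blockJacobi_domain A B 0 v⟩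
      = lp.single 2 1 ((A 0)ᴴ.toEuclideanLin v) + lp.single 2 0 ((B 0).toEuclideanLin v) := by
  apply lp.ext
  funext n
  rw [blockJacobi_apply, lp.coeFn_add, Pi.add_apply]
  rcases n with _ | _ | n <;> simp [blockJacobiSeq, lp.single_apply]

theorem blockJacobi_single_succ (k : ℕ) (v : EuclideanSpace ℂ (Fin N)) :
    blockJacobi A B ⟨lp.single 2 (k + 1) v, single_mem_blockJacobi_domain A B (k + 1) v⟩
      = lp.single 2 (k + 2) ((A (k + 1))ᴴ.toEuclideanLin v)
        + lp.single 2 (k + 1) ((B (k + 1)).toEuclideanLin v)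
        + lp.single 2 k ((A k).toEuclideanLin v) := by
  apply lp.ext
  funext n
  rw [blockJacobi_apply, lp.coeFn_add, Pi.add_apply, lp.coeFn_add, Pi.add_apply]
  rcases n with _ | n
  · simp only [blockJacobiSeq, lp.single_apply, Pi.single_apply]
    by_cases h : 0 = k
    · subst h
      simp
    · simp [h, Ne.symm h]
  · simp only [blockJacobiSeq, lp.single_apply, Pi.single_apply]
    by_cases h1 : n + 1 = k
    · subst h1
      simp [show ¬ n = n + 1 + 1 by omega]
    by_cases h2 : n = k
    · subst h2
      simp
    by_cases h3 : n = k + 1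
    · subst h3
      simp [show ¬ k + 1 + 1 = k by omega]
    simp [h1, h2, h3]

end BlockJacobi

/-! ### The isometry `ℓ²(ℂ^N) → L²_v(μ)` -/

namespace MatrixMeasure

variable {N : ℕ} {μ : MatrixMeasure N} {P : ℕ → Polynomial (Matrix (Fin N) (Fin N) ℂ)}

theorem inner_toL2v_poly (hμ : μ.IsAdmissible) (P Q : Polynomial (Matrix (Fin N) (Fin N) ℂ))
    (v w : Fin N → ℂ) :
    inner ℂ (μ.toL2v _ (μ.poly_mem_preL2 hμ P v)) (μ.toL2v _ (μ.poly_mem_preL2 hμ Q w))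
      = star v ⬝ᵥ (μ.gram P Q *ᵥ w) := by
  rw [inner_toL2v, gram, ← μ.setIntegral_form_poly hμ, setIntegral_univ]

/-- The isometry `v ↦ P_n^* v` from `ℂ^N` into `L²_v(μ)`. -/
def polyIso (hμ : μ.IsAdmissible) (hP : μ.IsOrthonormalSeq P) (n : ℕ) :
    EuclideanSpace ℂ (Fin N) →ₗᵢ[ℂ] μ.L2v where
  toFun v := μ.toL2v _ (μ.poly_mem_preL2 hμ (P n) v.ofLp)
  map_add' v w := by
    rw [toL2v_add]
    congr 1
    funext x
    exact mulVec_add _ _ _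
  map_smul' c v := by
    rw [RingHom.id_apply, smul_toL2v]
    congr 1
    funext x
    exact mulVec_smul _ _ _
  norm_map' v := by
    change ‖μ.toL2v _ (μ.poly_mem_preL2 hμ (P n) v.ofLp)‖ = ‖v‖
    rw [← sq_eq_sq₀ (norm_nonneg _) (norm_nonneg _), ← inner_self_eq_norm_sq (𝕜 := ℂ),
      ← inner_self_eq_norm_sq (𝕜 := ℂ), inner_toL2v_poly hμ, hP.gram_eq, if_pos rfl, one_mulVec,
      EuclideanSpace.inner_eq_star_dotProduct, dotProduct_comm]

theorem polyIso_apply (hμ : μ.IsAdmissible) (hP : μ.IsOrthonormalSeq P) (n : ℕ)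
    (v : EuclideanSpace ℂ (Fin N)) :
    polyIso hμ hP n v = μ.toL2v _ (μ.poly_mem_preL2 hμ (P n) v.ofLp) := rfl

theorem orthogonalFamily_polyIso (hμ : μ.IsAdmissible) (hP : μ.IsOrthonormalSeq P) :
    OrthogonalFamily ℂ (fun _ : ℕ => EuclideanSpace ℂ (Fin N)) (polyIso hμ hP) := by
  intro n m hnm v w
  rw [polyIso_apply, polyIso_apply, inner_toL2v_poly hμ, hP.gram_eq, if_neg hnm, zero_mulVec,
    dotProduct_zero]

/-- Multiplication by the variable acts on `P_0^* v` through the recurrence coefficients. -/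
theorem polyIso_zero_mem_mulVarGraph (hμ : μ.IsAdmissible) (hP : μ.IsOrthonormalSeq P)
    (v : EuclideanSpace ℂ (Fin N)) :
    (polyIso hμ hP 0 v, polyIso hμ hP 1 ((μ.coeffA P 0)ᴴ.toEuclideanLin v)
      + polyIso hμ hP 0 ((μ.coeffB P 0).toEuclideanLin v)) ∈ μ.mulVarGraph := by
  have h : (fun x : ℝ => (x : ℂ) • (((P 0).evalReal x)ᴴ *ᵥ v.ofLp))
      = (fun x : ℝ => ((P 1).evalReal x)ᴴ *ᵥ ((μ.coeffA P 0)ᴴ.toEuclideanLin v).ofLp)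
        + fun x : ℝ => ((P 0).evalReal x)ᴴ *ᵥ ((μ.coeffB P 0).toEuclideanLin v).ofLp := by
    funext x
    have h1 := congrArg (fun Q => (Polynomial.evalReal Q x)ᴴ *ᵥ v.ofLp) (hP.recurrence_zero hμ)
    simp only [Polynomial.evalReal_X_mul, Polynomial.evalReal_add, Polynomial.evalReal_C_mul,
      conjTranspose_smul, conjTranspose_add, conjTranspose_mul, Complex.star_def,
      Complex.conj_ofReal, smul_mulVec, add_mulVec, ← mulVec_mulVec,
      (isHermitian_coeffB 0).eq] at h1
    exact h1
  refine μ.mem_mulVarGraph_iff.2 ⟨_, μ.poly_mem_preL2 hμ (P 0) v.ofLp, ?_, rfl, ?_⟩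
  · rw [h]
    exact μ.preL2.add_mem (μ.poly_mem_preL2 hμ _ _) (μ.poly_mem_preL2 hμ _ _)
  · simp only [h]
    rfl

/-- Multiplication by the variable acts on `P_{n+1}^* v` through the recurrence coefficients. -/
theorem polyIso_succ_mem_mulVarGraph (hμ : μ.IsAdmissible) (hP : μ.IsOrthonormalSeq P) (n : ℕ)
    (v : EuclideanSpace ℂ (Fin N)) :
    (polyIso hμ hP (n + 1) v, polyIso hμ hP (n + 2) ((μ.coeffA P (n + 1))ᴴ.toEuclideanLin v)
      + polyIso hμ hP (n + 1) ((μ.coeffB P (n + 1)).toEuclideanLin v)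
      + polyIso hμ hP n ((μ.coeffA P n).toEuclideanLin v)) ∈ μ.mulVarGraph := by
  have h : (fun x : ℝ => (x : ℂ) • (((P (n + 1)).evalReal x)ᴴ *ᵥ v.ofLp))
      = (fun x : ℝ => ((P (n + 2)).evalReal x)ᴴ *ᵥ
          ((μ.coeffA P (n + 1))ᴴ.toEuclideanLin v).ofLp)
        + (fun x : ℝ => ((P (n + 1)).evalReal x)ᴴ *ᵥ
          ((μ.coeffB P (n + 1)).toEuclideanLin v).ofLp)
        + fun x : ℝ => ((P n).evalReal x)ᴴ *ᵥ ((μ.coeffA P n).toEuclideanLin v).ofLp := by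
    funext x
    have h1 := congrArg (fun Q => (Polynomial.evalReal Q x)ᴴ *ᵥ v.ofLp) (hP.recurrence_succ hμ n)
    simp only [Polynomial.evalReal_X_mul, Polynomial.evalReal_add, Polynomial.evalReal_C_mul,
      conjTranspose_smul, conjTranspose_add, conjTranspose_mul, conjTranspose_conjTranspose,
      Complex.star_def, Complex.conj_ofReal, smul_mulVec, add_mulVec, ← mulVec_mulVec,
      (isHermitian_coeffB (n + 1)).eq] at h1
    exact h1
  refine μ.mem_mulVarGraph_iff.2 ⟨_, μ.poly_mem_preL2 hμ (P (n + 1)) v.ofLp, ?_, rfl, ?_⟩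
  · rw [h]
    exact μ.preL2.add_mem (μ.preL2.add_mem (μ.poly_mem_preL2 hμ _ _) (μ.poly_mem_preL2 hμ _ _))
      (μ.poly_mem_preL2 hμ _ _)
  · simp only [h]
    rfl

section Complete

variable [CompleteSpace μ.L2v]

/-- The isometry `∑ e_n ⊗ v_n ↦ ∑ P_n^* v_n` from `ℓ²(ℂ^N)` into `L²_v(μ)`. -/
def seriesIso (hμ : μ.IsAdmissible) (hP : μ.IsOrthonormalSeq P) : BlockEll2 N →ₗᵢ[ℂ] μ.L2v :=
  (orthogonalFamily_polyIso hμ hP).linearIsometry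

theorem seriesIso_single (hμ : μ.IsAdmissible) (hP : μ.IsOrthonormalSeq P) (k : ℕ)
    (v : EuclideanSpace ℂ (Fin N)) :
    seriesIso hμ hP (lp.single 2 k v) = polyIso hμ hP k v :=
  (orthogonalFamily_polyIso hμ hP).linearIsometry_apply_single v

/-- The isometry carries the block Jacobi operator into multiplication by the variable. -/
theorem seriesIso_blockJacobi_mem (hμ : μ.IsAdmissible) (hP : μ.IsOrthonormalSeq P)
    (V : (blockJacobi (μ.coeffA P) (μ.coeffB P)).domain) :
    (seriesIso hμ hP (V : BlockEll2 N),
      seriesIso hμ hP (blockJacobi (μ.coeffA P) (μ.coeffB P) V)) ∈ μ.mulVarGraph := by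
  induction V using blockJacobi_domain_induction with
  | h0 =>
    rw [LinearPMap.map_zero, Submodule.coe_zero, map_zero]
    exact μ.mulVarGraph.zero_mem
  | hadd V W hV hW =>
    rw [LinearPMap.map_add, Submodule.coe_add, map_add, map_add]
    exact μ.mulVarGraph.add_mem hV hW
  | hsingle k v =>
    rcases k with _ | k
    · rw [blockJacobi_single_zero]
      simp only [map_add, seriesIso_single]
      exact polyIso_zero_mem_mulVarGraph hμ hP v
    · rw [blockJacobi_single_succ]
      simp only [map_add, seriesIso_single]
      exact polyIso_succ_mem_mulVarGraph hμ hP k v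

theorem isClosed_range_seriesIso (hμ : μ.IsAdmissible) (hP : μ.IsOrthonormalSeq P) :
    IsClosed ((LinearMap.range (seriesIso hμ hP).toLinearMap : Submodule ℂ μ.L2v) : Set μ.L2v) :=
  (seriesIso hμ hP).isometry.isUniformInducing.isComplete_range.isClosed

/-- The constants are in the range, as `P_0` is an invertible constant. -/
theorem const_mem_range_seriesIso (hμ : μ.IsAdmissible) (hP : μ.IsOrthonormalSeq P)
    (v : Fin N → ℂ) :
    μ.toL2v _ (μ.const_mem_preL2 v) ∈ LinearMap.range (seriesIso hμ hP).toLinearMap := by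
  have h0 : P 0 = Polynomial.C ((P 0).coeff 0) :=
    Polynomial.eq_C_of_natDegree_eq_zero (hP.natDegree 0)
  have hu : IsUnit ((P 0).coeff 0)ᴴ.det :=
    (Matrix.isUnit_iff_isUnit_det _).1 (hP.isUnit_coeff 0).star
  refine ⟨lp.single 2 0 (WithLp.toLp 2 ((((P 0).coeff 0)ᴴ)⁻¹ *ᵥ v)), ?_⟩
  refine (seriesIso_single hμ hP 0 _).trans ?_
  rw [polyIso_apply]
  congr 1
  funext x
  rw [h0, Polynomial.evalReal_C, Polynomial.coeff_C_zero, mulVec_mulVec,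
    Matrix.mul_nonsing_inv _ hu, one_mulVec]

/-- If the block Jacobi operator is essentially self-adjoint, the range of the isometry is
invariant under the resolvents of multiplication by the variable. -/
theorem resolvent_mem_range_seriesIso (hμ : μ.IsAdmissible) (hP : μ.IsOrthonormalSeq P)
    (hJ : IsEssentiallySelfAdjoint (blockJacobi (μ.coeffA P) (μ.coeffB P))) {c : ℂ}
    (hc : c.im ≠ 0) {u : μ.L2v} (hu : u ∈ LinearMap.range (seriesIso hμ hP).toLinearMap) :
    μ.mulBdd (IsBddMeasurable.resolvent hc) u ∈ LinearMap.range (seriesIso hμ hP).toLinearMap := by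
  obtain ⟨V, rfl⟩ := hu
  set J := blockJacobi (μ.coeffA P) (μ.coeffB P) with hJdef
  let K := LinearMap.range (seriesIso hμ hP).toLinearMap
  let L : BlockEll2 N →L[ℂ] μ.L2v :=
    μ.mulBdd (IsBddMeasurable.resolvent hc) ∘L (seriesIso hμ hP).toContinuousLinearMap
  have hS : IsClosed ((K.comap L.toLinearMap : Submodule ℂ (BlockEll2 N)) : Set (BlockEll2 N)) :=
    (isClosed_range_seriesIso hμ hP).preimage L.continuous
  have hle : (LinearMap.range (J.toFun + c • J.domain.subtype)).topologicalClosure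
      ≤ K.comap L.toLinearMap := by
    refine Submodule.topologicalClosure_minimal _ ?_ hS
    rintro _ ⟨W, rfl⟩
    refine ⟨(W : BlockEll2 N), ?_⟩
    change seriesIso hμ hP (W : BlockEll2 N) = μ.mulBdd (IsBddMeasurable.resolvent hc)
      (seriesIso hμ hP (J W + c • (W : BlockEll2 N)))
    rw [map_add, map_smul]
    exact (μ.mulBdd_resolvent_eq hc (seriesIso_blockJacobi_mem hμ hP W)).symm
  rw [hJ.range_add_smul_dense (dense_finiteVectors N) hc] at hle
  exact hle (Submodule.mem_top : V ∈ ⊤)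

/-- If the block Jacobi operator is essentially self-adjoint, the isometry is onto. -/
theorem seriesIso_surjective (hμ : μ.IsAdmissible) (hP : μ.IsOrthonormalSeq P)
    (hJ : IsEssentiallySelfAdjoint (blockJacobi (μ.coeffA P) (μ.coeffB P))) :
    Function.Surjective (seriesIso hμ hP) :=
  LinearMap.range_eq_top.1 <| μ.eq_top_of_resolvent_invariant (isClosed_range_seriesIso hμ hP)
    (const_mem_range_seriesIso hμ hP)
    fun _ hc _ hu => resolvent_mem_range_seriesIso hμ hP hJ hc hu

end Complete

/-- A unitary that carries an essentially self-adjoint operator `T` into multiplication by the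
variable carries the adjoint of `T` onto it: symmetry of multiplication gives one inclusion of
graphs, and the existence of its resolvent the other. -/
theorem mem_adjoint_graph_iff {H : Type*} [NormedAddCommGroup H] [InnerProductSpace ℂ H]
    [CompleteSpace H] {T : H →ₗ.[ℂ] H} (hT : IsEssentiallySelfAdjoint T)
    (hd : Dense (T.domain : Set H)) (U : H ≃ₗᵢ[ℂ] μ.L2v)
    (hU : ∀ V : T.domain, (U V, U (T V)) ∈ μ.mulVarGraph) (V W : H) :
    (V, W) ∈ (T†).graph ↔ (U V, U W) ∈ μ.mulVarGraph := by
  have hback : ∀ V W : H, (U V, U W) ∈ μ.mulVarGraph → (V, W) ∈ (T†).graph := by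
    intro V W h
    have h1 : ∀ x : T.domain, inner ℂ W (x : H) = inner ℂ V (T x) := fun x => by
      rw [← U.inner_map_map, ← U.inner_map_map V]
      exact μ.inner_eq_of_mem_mulVarGraph h (hU x)
    have hV : V ∈ T†.domain := LinearPMap.mem_adjoint_domain_of_exists _ ⟨W, h1⟩
    have := T†.mem_graph ⟨V, hV⟩
    rwa [LinearPMap.adjoint_apply_eq hd ⟨V, hV⟩ h1] at this
  refine ⟨fun h => ?_, hback V W⟩
  have hI : Complex.I.im ≠ 0 := by simp
  set f := μ.mulBdd (IsBddMeasurable.resolvent hI) (U (W + Complex.I • V)) with hf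
  have h1 := μ.resolvent_mem_mulVarGraph hI (U (W + Complex.I • V))
  rw [← hf] at h1
  have h2 : (U.symm f, W + Complex.I • V - Complex.I • U.symm f) ∈ (T†).graph := by
    refine hback _ _ ?_
    rwa [map_sub, map_smul, U.apply_symm_apply]
  -- `V - U⁻¹ f` is an eigenvector of `T†` with eigenvalue `-i`, hence `0`
  have h3 : (V - U.symm f, -Complex.I • (V - U.symm f)) ∈ (T†).graph := by
    have h4 := (T†).graph.sub_mem h h2
    rw [Prod.mk_sub_mk] at h4
    convert h4 using 2
    rw [neg_smul, smul_sub]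
    abel
  obtain ⟨y, hy1, hy2⟩ := (LinearPMap.mem_graph_iff _).1 h3
  simp only at hy1 hy2
  have h5 := (hT.adjoint_symmetric hd).eq_zero_of_eq_smul (c := -Complex.I) (by simp) y
    (by rw [hy2, hy1])
  rw [hy1, sub_eq_zero] at h5
  rw [← h5, add_sub_cancel_right] at h2
  have h6 : f = U V := by rw [h5, U.apply_symm_apply]
  rw [h6] at h1
  rwa [map_add, map_smul, add_sub_cancel_right] at h1

end MatrixMeasure

end

theorem theorem4p14 {N : ℕ} (μ : MatrixMeasure N) (hμ : μ.IsAdmissible)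
    (P : ℕ → Polynomial (Matrix (Fin N) (Fin N) ℂ)) (hP : μ.IsOrthonormalSeq P)
    (hJ : IsEssentiallySelfAdjoint (blockJacobi (μ.coeffA P) (μ.coeffB P))) :
    -- `(A_n)`, `(B_n)` are the coefficients of the three-term recurrence
    (∀ n, IsUnit (μ.coeffA P n)) ∧ (∀ n, (μ.coeffB P n).IsHermitian) ∧
    Polynomial.X * P 0 = Polynomial.C (μ.coeffA P 0) * P 1 + Polynomial.C (μ.coeffB P 0) * P 0 ∧
    (∀ n, Polynomial.X * P (n + 1) = Polynomial.C (μ.coeffA P (n + 1)) * P (n + 2)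
      + Polynomial.C (μ.coeffB P (n + 1)) * P (n + 1)
      + Polynomial.C (μ.coeffA P n)ᴴ * P n) ∧
    -- the closure of `J` is its adjoint
    (blockJacobi (μ.coeffA P) (μ.coeffB P)).closure = (blockJacobi (μ.coeffA P) (μ.coeffB P))† ∧
    -- the unitary `𝒰`, given by a series that converges in `L²_v(μ)`
    ∃ hmem : ∀ (n : ℕ) (v : Fin N → ℂ), (fun x : ℝ => ((P n).evalReal x)ᴴ *ᵥ v) ∈ μ.preL2,
    ∃ U : BlockEll2 N ≃ₗᵢ[ℂ] μ.L2v,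
      (∀ V : BlockEll2 N,
        HasSum (fun n => μ.toL2v (fun x : ℝ => ((P n).evalReal x)ᴴ *ᵥ (V n).ofLp)
          (hmem n (V n).ofLp)) (U V)) ∧
      -- `𝒰 J^* = M_z 𝒰`, including equality of the domains
      (∀ V : BlockEll2 N, V ∈ (blockJacobi (μ.coeffA P) (μ.coeffB P))†.domain ↔
        U V ∈ μ.mulVar.domain) ∧
      (∀ (V : (blockJacobi (μ.coeffA P) (μ.coeffB P))†.domain) (h : U V ∈ μ.mulVar.domain),
        U ((blockJacobi (μ.coeffA P) (μ.coeffB P))† V) = μ.mulVar ⟨U V, h⟩) ∧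
      -- the spectral decomposition of `J^*`
      ∃ E : ResolutionOfIdentity (BlockEll2 N),
        E.IsSpectralMeasureOf (blockJacobi (μ.coeffA P) (μ.coeffB P))† ∧
        ∀ B : Set ℝ, MeasurableSet B → ∀ (k n : ℕ) (v w : EuclideanSpace ℂ (Fin N)),
          inner ℂ (lp.single 2 n w : BlockEll2 N) (E.proj B (lp.single 2 k v))
            = star w.ofLp ⬝ᵥ (μ.matIntegral B (fun _ => 1) (P n) (P k) *ᵥ v.ofLp) := by
  have := μ.completeSpace_L2v hμ
  have hd : Dense ((blockJacobi (μ.coeffA P) (μ.coeffB P)).domain : Set (BlockEll2 N)) :=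
    dense_finiteVectors N
  let U : BlockEll2 N ≃ₗᵢ[ℂ] μ.L2v :=
    LinearIsometryEquiv.ofSurjective (MatrixMeasure.seriesIso hμ hP)
      (MatrixMeasure.seriesIso_surjective hμ hP hJ)
  have hgraph := MatrixMeasure.mem_adjoint_graph_iff hJ hd U
    (MatrixMeasure.seriesIso_blockJacobi_mem hμ hP)
  refine ⟨hP.isUnit_coeffA hμ, MatrixMeasure.isHermitian_coeffB, hP.recurrence_zero hμ,
    hP.recurrence_succ hμ, hJ.closure_eq_adjoint hd, fun n v => μ.poly_mem_preL2 hμ (P n) v, U,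
    fun V => (MatrixMeasure.orthogonalFamily_polyIso hμ hP).hasSum_linearIsometry V,
    fun V => ?_, fun V h => ?_, μ.spectralResolution U,
    μ.isSpectralMeasureOf_spectralResolution U hgraph, fun B hB k n v w => ?_⟩
  · rw [LinearPMap.mem_domain_iff, μ.mem_mulVar_domain_iff]
    exact U.surjective.exists.trans (exists_congr fun W => (hgraph V W).symm) |>.symm
  · exact (μ.mulVar_apply_eq ((hgraph _ _).1 (LinearPMap.mem_graph _ V)) h).symm
  · rw [← μ.setIntegral_form_poly hμ]
    exact μ.inner_spectralProj U hB (μ.poly_mem_preL2 hμ _ _) (μ.poly_mem_preL2 hμ _ _)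
      (MatrixMeasure.seriesIso_single hμ hP k v) (MatrixMeasure.seriesIso_single hμ hP n w)
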